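/- **Setting.** Let $n,k\ge 1$ be integers and $M_1\ge M_2\ge 0$ be reals. Let $X\in\mathbb R^{n\times n}$ be a symmetric covariate matrix with zero diagonal. Write $\sigma(x)=1/(1+e^{-x})$, $1_n$ for the all-ones vector, $J=I_n-\frac1n 1_n1_n^\top$, $\langle M,N\rangle=\operatorname{Tr}(M^\top N)$, and $\|\cdot\|_F$, $\|\cdot\|_{\rm op}$ for the Frobenius and spectral norms. Say that a matrix $\Theta$ satisfies (B) if $$-M_1\le\Theta_{ij}\le -M_2\ \ (i\ne j),\qquad |\Theta_{ii}|\le M_1\ \ (1\le i\le n).\tag{B}$$ The true parameter of the inner-product model is $\Theta_\star=\alpha_\star1_n^\top+1_n\alpha_\star^\top+\beta_\star X+G_\star$ with $G_\star=Z_\star Z_\star^\top$, $Z_\star\in\mathbb R^{n\times k}$, $JZ_\star=Z_\star$, and $\Theta_\star$ satisfying (B). Put $P_{ij}=\sigma(\Theta_{\star,ij})$ for all $i,j$ (including $i=j$). Let $A$ be the adjacency matrix of an undirected graph on $n$ nodes without self-loops; in the model, the entries $A_{ij}$, $i<j$, are independent Bernoulli($P_{ij}$) variables. For $\lambda_n\in\mathbb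 R$ let $(\hat\alpha,\hat\beta,\hat G)$ be any solution of the convex program $$\min_{\alpha,\beta,G}\ -\sum_{i,j=1}^n\bigl\{A_{ij}\Theta_{ij}+\log(1-\sigma(\Theta_{ij}))\bigr\}+\lambda_n\operatorname{Tr}(G)$$ subject to $\Theta=\alpha1_n^\top+1_n\alpha^\top+\beta X+G$, $GJ=G$, $G$ positive semidefinite, and $\Theta$ satisfying (B). Let $\hat\Theta=\hat\alpha1_n^\top+1_n\hat\alpha^\top+\hat\beta X+\hat G$. Let $\mathcal F(n,k,M_1,M_2,X)$ be the set of all $\Theta=\alpha1_n^\top+1_n\alpha^\top+\beta X+ZZ^\top$ with $Z\in\mathbb R^{n\times k}$, $JZ=Z$, $\max_i\|Z_{i*}\|^2\le M_1/3$, $\|\alpha\|_\infty\le M_1/3$, $|\beta|\max_{i<j}|X_{ij}|\le M_1/3$ and $\max_{i\ne j}\Theta_{ij}\le -M_2$; when $X=0$ the three size bounds are replaced by $\max_i\|Z_{i*}\|^2\le M_1/2$ and $\|\alpha\|_\infty\le M_1/2$. **Theorem.** There is an absolute constant $M_0>0$ such that the following holds whenever $X=0$ or the stable rank of $X$ satisfies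 $\|X\|_F^2/\|X\|_{\rm op}^2\ge M_0k$. 1. There is an absolute constant $C>0$ such that, deterministically, for every $$\lambda_n\ge\max\Bigl\{2\|A-P\|_{\rm op},\ \frac{|\langle A-P,\,X/\|X\|_F\rangle|}{\sqrt k},\ 1\Bigr\}$$ (the middle term being $0$ if $X=0$), every solution of the convex program satisfies $$\|\hat G-G_\star\|_F^2\le C e^{2M_1}\lambda_n^2k,\qquad \|\hat\Theta-\Theta_\star\|_F^2\le C e^{2M_1}\lambda_n^2k.$$ 2. For every sufficiently large absolute constant $C_0$ there are constants $c,C>0$, depending only on $C_0$, such that with $\lambda_n=C_0\sqrt{\max\{ne^{-M_2},\log n\}}$, uniformly over all $\Theta_\star\in\mathcal F(n,k,M_1,M_2,X)$ that satisfy (B), with probability at least $1-n^{-c}$ every solution satisfies $$\|\hat G-G_\star\|_F^2\le C\psi_n^2,\qquad \|\hat\Theta-\Theta_\star\|_F^2\le C\psi_n^2,\qquad \psi_n^2=e^{2M_1}nk\max\Bigl\{e^{-M_2},\frac{\log n}{n}\Bigr\}.$$ -/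

import Mathlib

open MeasureTheory ProbabilityTheory

noncomputable section

namespace LatentSpace

/-- The Frobenius norm of a real square matrix. -/
def froNorm {n : ℕ} (M : Matrix (Fin n) (Fin n) ℝ) : ℝ :=
  Real.sqrt (∑ i, ∑ j, M i j ^ 2)

/-- The spectral norm: the operator norm on Euclidean space. -/
def opNorm {n : ℕ} (M : Matrix (Fin n) (Fin n) ℝ) : ℝ :=
  ‖Matrix.toEuclideanCLM (n := Fin n) (𝕜 := ℝ) M‖

/-- The trace inner product `⟨M, N⟩ = Tr(Mᵀ N)`. -/
def matInner {n : ℕ} (M N : Matrix (Fin n) (Fin n) ℝ) : ℝ :=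
  ∑ i, ∑ j, M i j * N i j

/-- The stable rank `‖X‖_F² / ‖X‖_op²`; it is only used for `X ≠ 0`. -/
def stableRank {n : ℕ} (X : Matrix (Fin n) (Fin n) ℝ) : ℝ :=
  froNorm X ^ 2 / opNorm X ^ 2

/-- The centering matrix `J = I - (1/n) 1 1ᵀ`. -/
def centering (n : ℕ) : Matrix (Fin n) (Fin n) ℝ :=
  1 - (n : ℝ)⁻¹ • Matrix.of fun _ _ => (1 : ℝ)

/-- `Θ = α 1ᵀ + 1 αᵀ + β X + G`. -/
def thetaMat {n : ℕ} (X : Matrix (Fin n) (Fin n) ℝ) (α : Fin n → ℝ) (β : ℝ)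
    (G : Matrix (Fin n) (Fin n) ℝ) : Matrix (Fin n) (Fin n) ℝ :=
  Matrix.of fun i j => α i + α j + β * X i j + G i j

/-- The entrywise sigmoid of `Θ`, diagonal included. -/
def probMat {n : ℕ} (Θ : Matrix (Fin n) (Fin n) ℝ) : Matrix (Fin n) (Fin n) ℝ :=
  Matrix.of fun i j => Real.sigmoid (Θ i j)

/-- `-M₁ ≤ Θ i j ≤ -M₂` off the diagonal and `|Θ i i| ≤ M₁` on it. -/
def ThetaConstraint {n : ℕ} (M₁ M₂ : ℝ) (Θ : Matrix (Fin n) (Fin n) ℝ) : Prop :=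
  (∀ i j, i ≠ j → -M₁ ≤ Θ i j ∧ Θ i j ≤ -M₂) ∧ ∀ i, |Θ i i| ≤ M₁

/-- Symmetric pairwise covariates, with zero diagonal. -/
def IsCovariate {n : ℕ} (X : Matrix (Fin n) (Fin n) ℝ) : Prop :=
  X.IsSymm ∧ ∀ i, X i i = 0

/-- Adjacency matrices of undirected graphs without self-loops. -/
def IsAdjacency {n : ℕ} (A : Matrix (Fin n) (Fin n) ℝ) : Prop :=
  A.IsSymm ∧ (∀ i, A i i = 0) ∧ ∀ i j, A i j = 0 ∨ A i j = 1

/-- The sum over all `(i, j)` of `-(A i j * Θ i j + log (1 - σ (Θ i j)))`, plus `lam * Tr G`. -/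
def penalizedLoss {n : ℕ} (A X : Matrix (Fin n) (Fin n) ℝ) (lam : ℝ) (α : Fin n → ℝ) (β : ℝ)
    (G : Matrix (Fin n) (Fin n) ℝ) : ℝ :=
  -(∑ i, ∑ j, (A i j * thetaMat X α β G i j
      + Real.log (1 - Real.sigmoid (thetaMat X α β G i j)))) + lam * G.trace

/-- The constraints of the convex program. -/
def IsFeasible {n : ℕ} (X : Matrix (Fin n) (Fin n) ℝ) (M₁ M₂ : ℝ) (α : Fin n → ℝ) (β : ℝ)
    (G : Matrix (Fin n) (Fin n) ℝ) : Prop :=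
  G * centering n = G ∧ G.PosSemidef ∧ ThetaConstraint M₁ M₂ (thetaMat X α β G)

/-- `(α, β, G)` solves the convex program: a global minimizer among feasible points. -/
def IsSolution {n : ℕ} (A X : Matrix (Fin n) (Fin n) ℝ) (M₁ M₂ lam : ℝ) (α : Fin n → ℝ) (β : ℝ)
    (G : Matrix (Fin n) (Fin n) ℝ) : Prop :=
  IsFeasible X M₁ M₂ α β G ∧
    ∀ (α' : Fin n → ℝ) (β' : ℝ) (G' : Matrix (Fin n) (Fin n) ℝ), IsFeasible X M₁ M₂ α' β' G' →
      penalizedLoss A X lam α β G ≤ penalizedLoss A X lam α' β' G'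

/-- The parameter space of the inner-product model: `(α, β, Z)` parametrizes
`Θ = α 1ᵀ + 1 αᵀ + β X + Z Zᵀ`. The size bounds are `M₁ / 3` if `X ≠ 0` and `M₁ / 2` if `X = 0`. -/
def InParamSpace {n k : ℕ} (M₁ M₂ : ℝ) (X : Matrix (Fin n) (Fin n) ℝ) (α : Fin n → ℝ) (β : ℝ)
    (Z : Matrix (Fin n) (Fin k) ℝ) : Prop :=
  centering n * Z = Z ∧
  (X ≠ 0 → (∀ i, ∑ l, Z i l ^ 2 ≤ M₁ / 3) ∧ (∀ i, |α i| ≤ M₁ / 3) ∧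
    ∀ i j, i < j → |β| * |X i j| ≤ M₁ / 3) ∧
  (X = 0 → (∀ i, ∑ l, Z i l ^ 2 ≤ M₁ / 2) ∧ ∀ i, |α i| ≤ M₁ / 2) ∧
  ∀ i j, i ≠ j → thetaMat X α β (Z * Z.transpose) i j ≤ -M₂

/-- A random adjacency matrix whose entries above the diagonal are independent
Bernoulli variables with means `P i j`. -/
structure IsBernoulliNetwork {n : ℕ} {Ω : Type*} [MeasurableSpace Ω] (μ : Measure Ω)
    (P : Matrix (Fin n) (Fin n) ℝ) (A : Ω → Matrix (Fin n) (Fin n) ℝ) : Prop where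
  measurable_entry : ∀ i j, Measurable fun ω => A ω i j
  adjacency : ∀ ω, IsAdjacency (A ω)
  prob_one : ∀ i j, i < j → μ {ω | A ω i j = 1} = ENNReal.ofReal (P i j)
  indep : iIndepFun (fun (e : {e : Fin n × Fin n // e.1 < e.2}) ω => A ω e.1.1 e.1.2) μ

/-- `ψ² = e^{2 M₁} n k max {e^{-M₂}, log n / n}`. -/
def psiSq (n k : ℕ) (M₁ M₂ : ℝ) : ℝ :=
  Real.exp (2 * M₁) * n * k * max (Real.exp (-M₂)) (Real.log n / n)

end LatentSpace

end

/-! ### Norms, trace duality and projections for real square matrices. -/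

namespace LatentSpace

open Matrix

variable {n : ℕ}

/-! Deterministic part. The logistic loss has curvature at least `exp (-M₁) / 4` on `[-M₁, M₁]`, so
comparing a minimizer with the truth (`IsSolution.basic_ineq`) bounds `exp (-M₁) / 8` times the
squared error of `Θ`, plus `lam` times the trace of `D = Gh - G`, by the inner product of the noise
`A - P` with the error. Off the column space of `Z` the matrix `D` is positive semidefinite, so the
trace `t` of that block is its nuclear norm; the remainder costs only `√k` times the Frobenius norm
of `D` (`exists_lowRank_trace_bound`). As `lam` is at least twice the spectral norm of the noise,
the penalty absorbs half of `t`, and `t` is bounded by the other errors. Centering makes `D`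
orthogonal to the `α` part, and a large stable rank makes `X` nearly orthogonal to everything else,
so the error of `Θ` controls its three components separately. `error_bound_of_ineqs` solves the
resulting quadratic inequality.

Random part. It remains to bound the spectral norm of `A - P` by a multiple of `√d`, `d = max (n *
exp (-M₂)) (log n)`, without an extra logarithm. The moment of order `2 * m` of the trace is a sum
over closed walks that use each edge at least twice, weighted by `p` to the number of edges. These
walks are never counted: `sum_doubled_pow_card_le` compares them, one coincidence pattern at a time,
with the same walks on `2 * m` vertices, and the latter are dominated by the trace moment of a dense
random matrix of size `2 * m` (`card_isDoubled_le`). The spectral norm of the dense matrix is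
controlled by averaging powers of its sub-Gaussian quadratic form over a ball, in place of a net
argument. Markov's inequality with `m` a power of two between `d` and `4 * d` gives the tail bound,
and Hoeffding's inequality handles the noise in the direction of `X`. -/

lemma froNorm_nonneg (M : Matrix (Fin n) (Fin n) ℝ) : 0 ≤ froNorm M := Real.sqrt_nonneg _

lemma opNorm_nonneg (M : Matrix (Fin n) (Fin n) ℝ) : 0 ≤ opNorm M := norm_nonneg _

lemma froNorm_sq (M : Matrix (Fin n) (Fin n) ℝ) : froNorm M ^ 2 = ∑ i, ∑ j, M i j ^ 2 :=
  Real.sq_sqrt (Finset.sum_nonneg fun _ _ => Finset.sum_nonneg fun _ _ => sq_nonneg _)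

lemma matInner_self (M : Matrix (Fin n) (Fin n) ℝ) : matInner M M = froNorm M ^ 2 := by
  rw [froNorm_sq]; simp [matInner, sq]

lemma matInner_eq_trace (M N : Matrix (Fin n) (Fin n) ℝ) : matInner M N = (Mᵀ * N).trace := by
  simp only [matInner, trace, diag_apply, mul_apply, transpose_apply]
  exact Finset.sum_comm

lemma matInner_comm (M N : Matrix (Fin n) (Fin n) ℝ) : matInner M N = matInner N M := by
  simp [matInner, mul_comm]

lemma matInner_add_right (M N N' : Matrix (Fin n) (Fin n) ℝ) :
    matInner M (N + N') = matInner M N + matInner M N' := by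
  simp [matInner_eq_trace, mul_add]

lemma matInner_smul_right (c : ℝ) (M N : Matrix (Fin n) (Fin n) ℝ) :
    matInner M (c • N) = c * matInner M N := by
  simp [matInner_eq_trace]

lemma froNorm_smul (c : ℝ) (M : Matrix (Fin n) (Fin n) ℝ) : froNorm (c • M) = |c| * froNorm M := by
  rw [froNorm, froNorm, ← Real.sqrt_sq_eq_abs, ← Real.sqrt_mul (sq_nonneg c)]
  simp [mul_pow, Finset.mul_sum]

lemma abs_matInner_le (M N : Matrix (Fin n) (Fin n) ℝ) :
    |matInner M N| ≤ froNorm M * froNorm N := by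
  apply abs_le_of_sq_le_sq _ (mul_nonneg (froNorm_nonneg _) (froNorm_nonneg _))
  rw [mul_pow, froNorm_sq, froNorm_sq]
  simp only [matInner, ← Finset.sum_product', Finset.univ_product_univ]
  exact Finset.sum_mul_sq_le_sq_mul_sq _ _ _

lemma froNorm_add_le (M N : Matrix (Fin n) (Fin n) ℝ) :
    froNorm (M + N) ≤ froNorm M + froNorm N := by
  apply le_of_sq_le_sq _ (add_nonneg (froNorm_nonneg _) (froNorm_nonneg _))
  have h : froNorm (M + N) ^ 2 = froNorm M ^ 2 + 2 * matInner M N + froNorm N ^ 2 := by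
    rw [← matInner_self, matInner_add_right, matInner_comm _ M, matInner_comm _ N,
      matInner_add_right, matInner_add_right, matInner_self, matInner_self, matInner_comm N M]
    ring
  have := (le_abs_self _).trans (abs_matInner_le M N)
  nlinarith

lemma froNorm_transpose (M : Matrix (Fin n) (Fin n) ℝ) : froNorm Mᵀ = froNorm M := by
  simp only [froNorm, transpose_apply]
  rw [Finset.sum_comm]

/-- The squared Euclidean norm of `E *ᵥ x` is at most `‖E‖² ‖x‖²`. -/
lemma sum_mulVec_sq_le (E : Matrix (Fin n) (Fin n) ℝ) (x : Fin n → ℝ) :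
    ∑ i, (E *ᵥ x) i ^ 2 ≤ opNorm E ^ 2 * ∑ i, x i ^ 2 := by
  have h := (Matrix.toEuclideanCLM (n := Fin n) (𝕜 := ℝ) E).le_opNorm (WithLp.toLp 2 x)
  have h2 := pow_le_pow_left₀ (norm_nonneg _) h 2
  rw [mul_pow, EuclideanSpace.real_norm_sq_eq, EuclideanSpace.real_norm_sq_eq] at h2
  exact h2

lemma froNorm_mul_le (E M : Matrix (Fin n) (Fin n) ℝ) :
    froNorm (E * M) ≤ opNorm E * froNorm M := by
  apply le_of_sq_le_sq _ (mul_nonneg (opNorm_nonneg _) (froNorm_nonneg _))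
  rw [mul_pow, froNorm_sq, froNorm_sq, Finset.sum_comm, Finset.sum_comm (f := fun i j => M i j ^ 2),
    Finset.mul_sum]
  exact Finset.sum_le_sum fun j _ => sum_mulVec_sq_le E fun i => M i j

lemma opNorm_le_froNorm (M : Matrix (Fin n) (Fin n) ℝ) : opNorm M ≤ froNorm M := by
  refine ContinuousLinearMap.opNorm_le_bound _ (froNorm_nonneg _) fun x => ?_
  apply le_of_sq_le_sq _ (mul_nonneg (froNorm_nonneg _) (norm_nonneg _))
  rw [mul_pow, EuclideanSpace.real_norm_sq_eq, EuclideanSpace.real_norm_sq_eq, froNorm_sq,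
    Finset.sum_mul]
  refine Finset.sum_le_sum fun i _ => ?_
  exact Finset.sum_mul_sq_le_sq_mul_sq Finset.univ (M i) x.ofLp

lemma opNorm_add_le (M N : Matrix (Fin n) (Fin n) ℝ) : opNorm (M + N) ≤ opNorm M + opNorm N := by
  rw [opNorm, map_add]; exact norm_add_le _ _

/-- Duality of spectral and nuclear norm for a Gram matrix: move one factor to the side of `E` and
apply Cauchy–Schwarz; the two Frobenius norms of `Cᵀ` multiply to the trace. -/
lemma abs_matInner_transpose_mul_self_le (E C : Matrix (Fin n) (Fin n) ℝ) :
    |matInner E (Cᵀ * C)| ≤ opNorm E * (Cᵀ * C).trace := by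
  have h1 : matInner E (Cᵀ * C) = matInner (E * Cᵀ) Cᵀ := by
    rw [matInner_eq_trace, matInner_eq_trace, transpose_mul, transpose_transpose,
      ← trace_mul_cycle, mul_assoc, ← mul_assoc]
  have h2 : (Cᵀ * C).trace = froNorm Cᵀ ^ 2 := by
    rw [froNorm_transpose, ← matInner_self, matInner_eq_trace]
  rw [h1, h2, sq, ← mul_assoc]
  exact (abs_matInner_le _ _).trans
    (mul_le_mul_of_nonneg_right (froNorm_mul_le _ _) (froNorm_nonneg _))

lemma abs_matInner_posSemidef_le (E : Matrix (Fin n) (Fin n) ℝ) {B : Matrix (Fin n) (Fin n) ℝ}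
    (hB : B.PosSemidef) : |matInner E B| ≤ opNorm E * B.trace := by
  obtain ⟨C, rfl⟩ : ∃ C : Matrix (Fin n) (Fin n) ℝ, B = Cᵀ * C := by
    open scoped MatrixOrder in
    obtain ⟨C, hC⟩ := CStarAlgebra.nonneg_iff_eq_star_mul_self.mp hB.nonneg
    exact ⟨C, by rw [hC, star_eq_conjTranspose, conjTranspose_eq_transpose_of_trivial]⟩
  exact abs_matInner_transpose_mul_self_le E C

/-- For rank one the nuclear and Frobenius norms agree, so the `α` part of the error pays no
dimensional factor. -/
lemma abs_matInner_vecMulVec_le (E : Matrix (Fin n) (Fin n) ℝ) (x y : Fin n → ℝ) :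
    |matInner E (vecMulVec x y)| ≤ opNorm E * froNorm (vecMulVec x y) := by
  have h1 : matInner E (vecMulVec x y) = ∑ i, x i * (E *ᵥ y) i := by
    simp only [matInner, vecMulVec_apply, mulVec, dotProduct, Finset.mul_sum]
    exact Finset.sum_congr rfl fun i _ => Finset.sum_congr rfl fun j _ => by ring
  apply abs_le_of_sq_le_sq _ (mul_nonneg (opNorm_nonneg _) (froNorm_nonneg _))
  have h2 : froNorm (vecMulVec x y) ^ 2 = (∑ i, x i ^ 2) * ∑ i, y i ^ 2 := by
    rw [froNorm_sq, Finset.sum_mul_sum]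
    simp [vecMulVec_apply, mul_pow]
  rw [h1, mul_pow, h2]
  refine (Finset.sum_mul_sq_le_sq_mul_sq _ _ _).trans ?_
  have := mul_le_mul_of_nonneg_left (sum_mulVec_sq_le E y)
    (Finset.sum_nonneg fun i (_ : i ∈ Finset.univ) => sq_nonneg (x i))
  linarith

/-- Orthogonal projection onto the column space of `Z`. -/
lemma exists_projection {k : ℕ} (Z : Matrix (Fin n) (Fin k) ℝ) :
    ∃ U : Matrix (Fin n) (Fin n) ℝ, Uᵀ = U ∧ U * U = U ∧ U * Z = Z ∧ froNorm U ≤ Real.sqrt k := by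
  let W : Submodule ℝ (EuclideanSpace ℝ (Fin n)) :=
    Submodule.span ℝ (Set.range fun l => WithLp.toLp 2 fun i => Z i l)
  have hW : Module.finrank ℝ W ≤ k :=
    (finrank_range_le_card (R := ℝ) fun l : Fin k => WithLp.toLp 2 fun i => Z i l).trans
      (Fintype.card_fin k).le
  -- With an orthonormal basis of the column space as the columns of `Q`, the projection is `Q *
  -- Qᵀ`, and its squared Frobenius norm is its rank.
  let b := stdOrthonormalBasis ℝ W
  let Q : Matrix (Fin n) (Fin (Module.finrank ℝ W)) ℝ := of fun i l => (b l : EuclideanSpace ℝ (Fin n)) i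
  have hQ : Qᵀ * Q = 1 := by
    ext l l'
    have := orthonormal_iff_ite.mp b.orthonormal l l'
    rw [Submodule.coe_inner, PiLp.inner_apply] at this
    rw [mul_apply, one_apply, ← this]
    exact Finset.sum_congr rfl fun i _ => mul_comm _ _
  have hU : (Q * Qᵀ) * (Q * Qᵀ) = Q * Qᵀ := by
    rw [Matrix.mul_assoc, ← Matrix.mul_assoc Qᵀ, hQ, Matrix.one_mul]
  refine ⟨Q * Qᵀ, by rw [transpose_mul, transpose_transpose], hU, ?_, ?_⟩
  · have hZ : Z = Q * of fun j l => inner ℝ (b j : EuclideanSpace ℝ (Fin n))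
        (WithLp.toLp 2 fun i => Z i l) := by
      ext i l
      have hmem : (WithLp.toLp 2 fun i => Z i l : EuclideanSpace ℝ (Fin n)) ∈ W :=
        Submodule.subset_span ⟨l, rfl⟩
      have h2 := congrArg (fun v : W => (v : EuclideanSpace ℝ (Fin n)) i) (b.sum_repr ⟨_, hmem⟩)
      simp only [b.repr_apply_apply, Submodule.coe_inner, Submodule.coe_sum, Submodule.coe_smul,
        WithLp.ofLp_sum, WithLp.ofLp_smul, Finset.sum_apply, Pi.smul_apply, smul_eq_mul] at h2
      rw [← h2, mul_apply]
      exact Finset.sum_congr rfl fun j _ => mul_comm _ _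
    generalize (of fun j l => inner ℝ (b j : EuclideanSpace ℝ (Fin n))
        (WithLp.toLp 2 fun i => Z i l)) = R at hZ
    rw [hZ, ← Matrix.mul_assoc, Matrix.mul_assoc Q, hQ, Matrix.mul_one]
  · apply Real.le_sqrt_of_sq_le
    rw [← matInner_self, matInner_eq_trace, transpose_mul, transpose_transpose, hU, trace_mul_comm,
      hQ, trace_one, Fintype.card_fin]
    exact_mod_cast hW

end LatentSpace

/-! ### Convexity of the logistic loss and the deterministic error bound. -/

namespace LatentSpace

open Matrix

/-- By symmetry take `x ≥ 0`; then the product equals `σ(x)² e^{-x}` with `σ(x) ≥ 1/2`. -/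
lemma exp_neg_div_four_le_sigmoid {M x : ℝ} (hx : |x| ≤ M) :
    Real.exp (-M) / 4 ≤ Real.sigmoid x * (1 - Real.sigmoid x) := by
  wlog h0 : 0 ≤ x generalizing x
  · have := this (x := -x) (by rwa [abs_neg]) (by linarith)
    rw [Real.sigmoid_neg] at this
    linarith
  rw [abs_of_nonneg h0] at hx
  have h1 : (1 : ℝ) / 2 ≤ Real.sigmoid x := by
    have := Real.sigmoid_le h0
    rw [Real.sigmoid_zero] at this
    linarith
  have h2 : 1 - Real.sigmoid x = Real.sigmoid x * Real.exp (-x) := by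
    rw [Real.sigmoid_mul_rexp_neg, Real.sigmoid_neg]
  have h3 : Real.exp (-M) ≤ Real.exp (-x) := Real.exp_le_exp.mpr (by linarith)
  have h4 := Real.exp_pos (-x)
  rw [h2]
  nlinarith [mul_nonneg (sub_nonneg.2 h1) h4.le, mul_nonneg (mul_nonneg (sub_nonneg.2 h1)
    (sub_nonneg.2 h1)) h4.le]

lemma hasDerivAt_neg_log_one_sub_sigmoid (x : ℝ) :
    HasDerivAt (fun y => -Real.log (1 - Real.sigmoid y)) (Real.sigmoid x) x := by
  have h1 : 1 - Real.sigmoid x ≠ 0 := by linarith [Real.sigmoid_lt_one x]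
  refine ((((Real.hasDerivAt_sigmoid x).const_sub 1).log h1).neg).congr_deriv ?_
  rw [neg_div, neg_neg, mul_div_cancel_right₀ _ h1]

/-- Strong convexity of the logistic loss on a bounded interval. -/
lemma neg_log_one_sub_sigmoid_ge {M x y : ℝ} (hx : |x| ≤ M) (hy : |y| ≤ M) :
    -Real.log (1 - Real.sigmoid x) + Real.sigmoid x * (y - x) + Real.exp (-M) / 8 * (y - x) ^ 2
      ≤ -Real.log (1 - Real.sigmoid y) := by
  set c := Real.exp (-M) / 4 with hc
  have hd : ∀ z, HasDerivAt (fun y => -Real.log (1 - Real.sigmoid y) - c / 2 * y ^ 2)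
      (Real.sigmoid z - c * z) z := fun z => by
    refine ((hasDerivAt_neg_log_one_sub_sigmoid z).sub
      ((hasDerivAt_pow 2 z).const_mul (c / 2))).congr_deriv ?_
    norm_num; ring
  have hd2 : ∀ z, HasDerivAt (fun y => Real.sigmoid y - c * y)
      (Real.sigmoid z * (1 - Real.sigmoid z) - c) z := fun z => by
    exact ((Real.hasDerivAt_sigmoid z).sub ((hasDerivAt_id z).const_mul c)).congr_deriv
      (by rw [mul_one])
  -- The second derivative of the loss is at least `c` here, so subtracting `c / 2 * y ^ 2` keeps it
  -- convex; the claim is the tangent-line inequality for the difference.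
  have hconv : ConvexOn ℝ (Set.Icc (-M) M)
      (fun y => -Real.log (1 - Real.sigmoid y) - c / 2 * y ^ 2) := by
    refine convexOn_of_hasDerivWithinAt2_nonneg (convex_Icc _ _)
      (fun z _ => (hd z).continuousAt.continuousWithinAt)
      (fun z _ => (hd z).hasDerivWithinAt) (fun z _ => (hd2 z).hasDerivWithinAt) fun z hz => ?_
    have := exp_neg_div_four_le_sigmoid (M := M) (x := z)
      (abs_le.mpr (Set.mem_Icc.mp (interior_subset hz)))
    linarith
  have key : (-Real.log (1 - Real.sigmoid x) - c / 2 * x ^ 2) + (Real.sigmoid x - c * x) * (y - x)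
      ≤ -Real.log (1 - Real.sigmoid y) - c / 2 * y ^ 2 := by
    rcases lt_trichotomy x y with h | h | h
    · have := hconv.le_slope_of_hasDerivAt (abs_le.mp hx) (abs_le.mp hy) h (hd x)
      rw [slope_def_field, le_div_iff₀ (by linarith)] at this
      linarith
    · subst h; linarith
    · have := hconv.slope_le_of_hasDerivAt (abs_le.mp hy) (abs_le.mp hx) h (hd x)
      rw [slope_def_field, div_le_iff₀ (by linarith)] at this
      linarith
  have e : Real.exp (-M) / 8 = c / 2 := by rw [hc]; ring
  rw [e]
  linarith [key]

variable {n : ℕ}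

lemma froNorm_sq_eq_add_of_projection {U : Matrix (Fin n) (Fin n) ℝ} (hUs : Uᵀ = U)
    (hUU : U * U = U) (M : Matrix (Fin n) (Fin n) ℝ) :
    froNorm M ^ 2 = froNorm (U * M) ^ 2 + froNorm ((1 - U) * M) ^ 2 := by
  simp only [← matInner_self, matInner_eq_trace, transpose_mul, transpose_sub, transpose_one, hUs]
  have h1 : Mᵀ * U * (U * M) = Mᵀ * U * M := by
    rw [mul_assoc, ← mul_assoc U, hUU, ← mul_assoc]
  have h2 : Mᵀ * (1 - U) * ((1 - U) * M) = Mᵀ * M - Mᵀ * U * M := by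
    have : (1 - U) * (1 - U) = 1 - U := by rw [mul_sub, sub_mul, sub_mul, hUU]; simp
    rw [mul_assoc, ← mul_assoc (1 - U), this, sub_mul, mul_sub, one_mul, mul_assoc]
  rw [h1, h2, trace_sub]
  ring

/-- The difference of a positive semidefinite matrix and one of rank at most `k` is controlled by
its Frobenius norm and a nonnegative scalar, the trace of its part off the column space of `Z`. -/
lemma exists_lowRank_trace_bound {k : ℕ} (Z : Matrix (Fin n) (Fin k) ℝ)
    {Gh : Matrix (Fin n) (Fin n) ℝ} (hGh : Gh.PosSemidef) :
    ∃ t : ℝ, 0 ≤ t ∧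
      (∀ E : Matrix (Fin n) (Fin n) ℝ, E.IsSymm → |matInner E (Gh - Z * Zᵀ)| ≤
        opNorm E * (2 * Real.sqrt k * froNorm (Gh - Z * Zᵀ) + t)) ∧
      t - Real.sqrt k * froNorm (Gh - Z * Zᵀ) ≤ (Gh - Z * Zᵀ).trace := by
  obtain ⟨U, hUs, hUU, hUZ, hUk⟩ := exists_projection Z
  set D := Gh - Z * Zᵀ with hD
  set V := 1 - U with hV
  have hVs : Vᵀ = V := by rw [hV, transpose_sub, transpose_one, hUs]
  have hVZ : V * Z = 0 := by rw [hV, Matrix.sub_mul, hUZ, Matrix.one_mul, sub_self]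
  have hUV : U * V = 0 := by rw [hV, mul_sub, hUU, mul_one, sub_self]
  -- `V` annihilates `Z`, so this block of the difference sees only `Gh` and inherits its
  -- positivity.
  have hB : V * D * V = V * Gh * V := by
    have : V * D = V * Gh := by
      rw [hD, mul_sub, ← Matrix.mul_assoc V Z, hVZ, Matrix.zero_mul, sub_zero]
    rw [this]
  have hBpsd : (V * D * V).PosSemidef := by
    have := hGh.mul_mul_conjTranspose_same V
    rwa [conjTranspose_eq_transpose_of_trivial, hVs, ← hB] at this
  have hdec : D = U * D + V * D * U + V * D * V := by
    have h1 : U + V = 1 := by rw [hV]; abel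
    rw [add_assoc, ← mul_add, h1, mul_one, ← add_mul, h1, one_mul]
  have hg := froNorm_nonneg D
  refine ⟨(V * D * V).trace, hBpsd.trace_nonneg, fun E hE => ?_, ?_⟩
  · have hEU : froNorm (E * U) ≤ opNorm E * Real.sqrt k :=
      (froNorm_mul_le _ _).trans (mul_le_mul_of_nonneg_left hUk (opNorm_nonneg _))
    have h1 : |matInner E (U * D)| ≤ opNorm E * Real.sqrt k * froNorm D := by
      have e : matInner E (U * D) = matInner (U * E) D := by
        rw [matInner_eq_trace, matInner_eq_trace, transpose_mul, hUs, mul_assoc]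
      rw [e]
      refine (abs_matInner_le _ _).trans (mul_le_mul_of_nonneg_right ?_ hg)
      rwa [← froNorm_transpose, transpose_mul, hUs, hE.eq]
    have h2 : |matInner E (V * D * U)| ≤ opNorm E * Real.sqrt k * froNorm D := by
      have e : matInner E (V * D * U) = matInner (V * (E * U)) D := by
        rw [matInner_eq_trace, matInner_eq_trace, transpose_mul, transpose_mul, hUs, hVs,
          ← mul_assoc, trace_mul_comm]
        simp only [mul_assoc]
      rw [e]
      refine (abs_matInner_le _ _).trans (mul_le_mul_of_nonneg_right (le_trans ?_ hEU) hg)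
      apply le_of_sq_le_sq _ (froNorm_nonneg _)
      rw [froNorm_sq_eq_add_of_projection hUs hUU (E * U)]
      nlinarith [sq_nonneg (froNorm (U * (E * U)))]
    have h3 := abs_matInner_posSemidef_le E hBpsd
    have h4 : matInner E D = matInner E (U * D) + matInner E (V * D * U)
        + matInner E (V * D * V) := by
      rw [← matInner_add_right, ← matInner_add_right, ← hdec]
    rw [h4]
    have := abs_add_three (matInner E (U * D)) (matInner E (V * D * U)) (matInner E (V * D * V))
    nlinarith
  · have h1 : D.trace = matInner U D + (V * D * V).trace := by
      conv_lhs => rw [hdec]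
      have : (V * D * U).trace = 0 := by
        rw [trace_mul_comm, ← mul_assoc, hUV, zero_mul, trace_zero]
      rw [trace_add, trace_add, this, matInner_eq_trace, hUs, add_zero]
    have h2 := neg_le_of_abs_le (abs_matInner_le U D)
    have := mul_le_mul_of_nonneg_right hUk hg
    rw [h1]
    linarith

/-- The constraint says that `G` times the all-ones matrix vanishes. Zero row sums are what makes
the `G` part orthogonal to the `α` part. -/
lemma sum_row_eq_zero_of_mul_centering {G : Matrix (Fin n) (Fin n) ℝ} (h : G * centering n = G)
    (i : Fin n) : ∑ j, G i j = 0 := by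
  have hn : (n : ℝ) ≠ 0 := by
    have : 0 < n := i.pos
    positivity
  have h1 := congrFun (congrFun h i) i
  rw [centering, mul_sub, mul_one, Matrix.mul_smul, Matrix.sub_apply, Matrix.smul_apply,
    mul_apply] at h1
  have h2 : (n : ℝ)⁻¹ * ∑ j, G i j = 0 := by simpa using h1
  exact (mul_eq_zero.mp h2).resolve_left (inv_ne_zero hn)

lemma transpose_centering : (centering n)ᵀ = centering n := by
  ext i j
  simp [centering, one_apply, eq_comm]

lemma mul_transpose_mul_centering {k : ℕ} {Z : Matrix (Fin n) (Fin k) ℝ}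
    (h : centering n * Z = Z) : Z * Zᵀ * centering n = Z * Zᵀ := by
  have h' : Zᵀ * centering n = Zᵀ := by
    rw [← transpose_centering, ← transpose_mul, h]
  rw [Matrix.mul_assoc, h']

lemma ThetaConstraint.abs_le {M₁ M₂ : ℝ} {Θ : Matrix (Fin n) (Fin n) ℝ}
    (h : ThetaConstraint M₁ M₂ Θ) (h2 : 0 ≤ M₂) (h12 : M₂ ≤ M₁) (i j : Fin n) : |Θ i j| ≤ M₁ := by
  by_cases hij : i = j
  · subst hij; exact h.2 i
  · have := h.1 i j hij
    exact _root_.abs_le.mpr ⟨this.1, by linarith⟩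

/-- The basic inequality of penalized logistic regression. -/
lemma IsSolution.basic_ineq {A X : Matrix (Fin n) (Fin n) ℝ} {M₁ M₂ lam : ℝ} (h2 : 0 ≤ M₂)
    (h12 : M₂ ≤ M₁) {α αh : Fin n → ℝ} {β βh : ℝ} {G Gh : Matrix (Fin n) (Fin n) ℝ}
    (hsol : IsSolution A X M₁ M₂ lam αh βh Gh) (hfeas : IsFeasible X M₁ M₂ α β G) :
    Real.exp (-M₁) / 8 * froNorm (thetaMat X αh βh Gh - thetaMat X α β G) ^ 2
        + lam * (Gh - G).trace
      ≤ matInner (A - probMat (thetaMat X α β G)) (thetaMat X αh βh Gh - thetaMat X α β G) := by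
  have h := hsol.2 α β G hfeas
  rw [penalizedLoss, penalizedLoss] at h
  set T := thetaMat X α β G
  set T' := thetaMat X αh βh Gh
  have hT := hfeas.2.2.abs_le h2 h12
  have hT' := hsol.1.2.2.abs_le h2 h12
  -- Strong convexity entry by entry; the gradient of the loss at the truth is `P - A`, which is how
  -- the noise enters.
  have hs : ∑ i, ∑ j, (Real.exp (-M₁) / 8 * (T' i j - T i j) ^ 2) ≤
      ∑ i, ∑ j, ((A i j - Real.sigmoid (T i j)) * (T' i j - T i j)
        + (A i j * T i j + Real.log (1 - Real.sigmoid (T i j)))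
        - (A i j * T' i j + Real.log (1 - Real.sigmoid (T' i j)))) := by
    refine Finset.sum_le_sum fun i _ => Finset.sum_le_sum fun j _ => ?_
    have := neg_log_one_sub_sigmoid_ge (hT i j) (hT' i j)
    linarith
  simp only [Finset.sum_sub_distrib, Finset.sum_add_distrib, ← Finset.mul_sum] at hs h
  have e1 : froNorm (T' - T) ^ 2 = ∑ i, ∑ j, (T' i j - T i j) ^ 2 := froNorm_sq _
  have e2 : matInner (A - probMat T) (T' - T)
      = ∑ i, ∑ j, (A i j - Real.sigmoid (T i j)) * (T' i j - T i j) := rfl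
  rw [e1, e2, trace_sub, mul_sub]
  linarith

/-- The scalar inequalities that conclude the deterministic error bound. -/
lemma error_bound_of_ineqs {e lam K D2 g a b t : ℝ} (he : 0 < e) (hlam : 0 ≤ lam) (hK : 1 ≤ K)
    (ha : 0 ≤ a) (hb : 0 ≤ b) (ht : 0 ≤ t) (hD2 : 0 ≤ D2)
    (h1 : e / 8 * D2 + lam * (t - K * g) ≤ lam / 2 * (2 * K * g + t) + lam * a + K * lam * b)
    (hlam1 : 0 < lam)
    (h2 : g ^ 2 + 2 * a ^ 2 + b ^ 2 - b / (50 * K) * (2 * K * g + t + 2 * a) ≤ D2) :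
    g ^ 2 + a ^ 2 + b ^ 2 ≤ 1536 * lam ^ 2 * K ^ 2 / e ^ 2 := by
  -- Half of `lam * t` survives on the left; dropping the curvature term gives the cone condition.
  have ht' : t ≤ 4 * K * g + 2 * a + 2 * K * b := by
    have : lam * (t / 2) ≤ lam * (2 * K * g + a + K * b) := by
      nlinarith [mul_nonneg he.le hD2]
    have := le_of_mul_le_mul_left this hlam1
    linarith
  have hcross : b / (50 * K) * (2 * K * g + t + 2 * a) ≤ b / 50 * (6 * g + 4 * a + 2 * b) := by
    have : b / (50 * K) * (2 * K * g + t + 2 * a) ≤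
        b / (50 * K) * (K * (6 * g + 4 * a + 2 * b)) := by
      apply mul_le_mul_of_nonneg_left _ (by positivity)
      nlinarith [mul_nonneg (sub_nonneg.2 hK) ha]
    refine this.trans (le_of_eq ?_)
    field_simp
  -- After the cone condition the cross terms carry the small factor `1/50`, so they eat at most
  -- half of the sum of squares.
  have hD : (g ^ 2 + a ^ 2 + b ^ 2) / 2 ≤ D2 := by
    nlinarith [sq_nonneg (g - b), sq_nonneg (a - b)]
  set S := g ^ 2 + a ^ 2 + b ^ 2 with hS
  have hS0 : 0 ≤ S := by positivity
  have hL : e / 16 * S ≤ lam * K * (2 * g + a + b) := by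
    have : e / 8 * D2 ≤ lam * K * (2 * g + a + b) := by
      nlinarith [mul_nonneg hlam ht, mul_nonneg (mul_nonneg hlam (sub_nonneg.2 hK)) ha]
    nlinarith
  have hsq : (2 * g + a + b) ^ 2 ≤ 6 * S := by
    -- Cauchy–Schwarz with `6 = 2² + 1 + 1`; the final constant is `1536 = 6 * 16²`.
    nlinarith [sq_nonneg (g - 2 * a), sq_nonneg (g - 2 * b), sq_nonneg (a - b)]
  have hL2 : (e / 16 * S) ^ 2 ≤ lam ^ 2 * K ^ 2 * (6 * S) := by
    calc (e / 16 * S) ^ 2 ≤ (lam * K * (2 * g + a + b)) ^ 2 :=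
          pow_le_pow_left₀ (by positivity) hL 2
      _ = lam ^ 2 * K ^ 2 * (2 * g + a + b) ^ 2 := by ring
      _ ≤ _ := by gcongr
  rw [le_div_iff₀ (by positivity)]
  rcases hS0.eq_or_lt with h0 | h0
  · rw [← h0]; simp; positivity
  · have : S * (S * e ^ 2) ≤ S * (1536 * lam ^ 2 * K ^ 2) := by nlinarith
    exact le_of_mul_le_mul_left this h0

lemma thetaMat_sub (X : Matrix (Fin n) (Fin n) ℝ) (α αh : Fin n → ℝ) (β βh : ℝ)
    (G Gh : Matrix (Fin n) (Fin n) ℝ) :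
    thetaMat X αh βh Gh - thetaMat X α β G =
      (vecMulVec (αh - α) (fun _ => 1) + vecMulVec (fun _ => 1) (αh - α)) +
        ((βh - β) • X + (Gh - G)) := by
  ext i j
  simp [thetaMat, vecMulVec_apply]
  ring

/-- The squared Frobenius norm of a perturbation of `Θ` splits up to its cross terms with `X`. -/
lemma froNorm_sq_perturbation (X D : Matrix (Fin n) (Fin n) ℝ) (a : Fin n → ℝ) (b : ℝ)
    (hD : ∀ i, ∑ j, D i j = 0) (hD' : ∀ j, ∑ i, D i j = 0) :
    froNorm D ^ 2 + 2 * froNorm (vecMulVec a (fun _ => 1)) ^ 2 + b ^ 2 * froNorm X ^ 2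
        + 2 * b * (matInner X (vecMulVec a fun _ => 1) + matInner X (vecMulVec (fun _ => 1) a)
          + matInner X D)
      ≤ froNorm ((vecMulVec a (fun _ => 1) + vecMulVec (fun _ => 1) a) + (b • X + D)) ^ 2 := by
  set R := vecMulVec a (fun _ : Fin n => (1 : ℝ)) with hR
  set R' := vecMulVec (fun _ : Fin n => (1 : ℝ)) a with hR'
  have h1 : matInner R D = 0 := by
    simp only [matInner, hR, vecMulVec_apply, mul_one, ← Finset.mul_sum, hD, mul_zero,
      Finset.sum_const_zero]
  have h2 : matInner R' D = 0 := by
    rw [matInner, Finset.sum_comm]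
    simp only [hR', vecMulVec_apply, one_mul, ← Finset.mul_sum, hD', mul_zero,
      Finset.sum_const_zero]
  have h3 : 0 ≤ matInner R R' := by
    have : matInner R R' = (∑ i, a i) ^ 2 := by
      rw [sq, Finset.sum_mul_sum]
      simp [matInner, hR, hR', vecMulVec_apply]
    rw [this]; positivity
  have h4 : froNorm R' = froNorm R := by
    rw [← froNorm_transpose R, hR, hR', transpose_vecMulVec]
  have h5 : froNorm ((R + R') + (b • X + D)) ^ 2 = froNorm D ^ 2 + froNorm R ^ 2 + froNorm R' ^ 2
      + b ^ 2 * froNorm X ^ 2 + 2 * matInner R R' + 2 * matInner R D + 2 * matInner R' D +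
      2 * b * (matInner X R + matInner X R' + matInner X D) := by
    simp only [← matInner_self]
    simp only [matInner, Matrix.add_apply, Matrix.smul_apply, smul_eq_mul]
    simp only [Finset.mul_sum, ← Finset.sum_add_distrib]
    exact Finset.sum_congr rfl fun i _ => Finset.sum_congr rfl fun j _ => by ring
  rw [h5, h4, h1, h2]
  linarith

set_option maxHeartbeats 1000000 in
/-- The deterministic error bound. -/
theorem deterministic_bound {k : ℕ} (hk : 1 ≤ k) {M₁ M₂ : ℝ} (h2 : 0 ≤ M₂) (h12 : M₂ ≤ M₁)
    {X : Matrix (Fin n) (Fin n) ℝ} (hX : IsCovariate X)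
    (hstab : X ≠ 0 → 10000 * k ≤ stableRank X)
    (α : Fin n → ℝ) (β : ℝ) (Z : Matrix (Fin n) (Fin k) ℝ) (hZ : centering n * Z = Z)
    (hΘ : ThetaConstraint M₁ M₂ (thetaMat X α β (Z * Zᵀ)))
    {A : Matrix (Fin n) (Fin n) ℝ} (hA : IsAdjacency A) {lam : ℝ}
    (hop : 2 * opNorm (A - probMat (thetaMat X α β (Z * Zᵀ))) ≤ lam)
    (hXE : |matInner (A - probMat (thetaMat X α β (Z * Zᵀ))) ((froNorm X)⁻¹ • X)| / Real.sqrt k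
      ≤ lam)
    (hlam : 1 ≤ lam) (αh : Fin n → ℝ) (βh : ℝ) (Gh : Matrix (Fin n) (Fin n) ℝ)
    (hsol : IsSolution A X M₁ M₂ lam αh βh Gh) :
    froNorm (Gh - Z * Zᵀ) ^ 2 ≤ 9216 * Real.exp (2 * M₁) * lam ^ 2 * k ∧
      froNorm (thetaMat X αh βh Gh - thetaMat X α β (Z * Zᵀ)) ^ 2
        ≤ 9216 * Real.exp (2 * M₁) * lam ^ 2 * k := by
  have hfeas : IsFeasible X M₁ M₂ α β (Z * Zᵀ) :=
    ⟨mul_transpose_mul_centering hZ, by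
      have := posSemidef_self_mul_conjTranspose Z
      rwa [conjTranspose_eq_transpose_of_trivial] at this, hΘ⟩
  have hbasic := hsol.basic_ineq h2 h12 hfeas
  obtain ⟨t, ht, htE, httr⟩ := exists_lowRank_trace_bound Z hsol.1.2.1
  have hrow : ∀ i, ∑ j, (Gh - Z * Zᵀ) i j = 0 := fun i => by
    simp only [Matrix.sub_apply, Finset.sum_sub_distrib]
    rw [sum_row_eq_zero_of_mul_centering hsol.1.1, sum_row_eq_zero_of_mul_centering hfeas.1,
      sub_zero]
  have hDsymm : (Gh - Z * Zᵀ)ᵀ = Gh - Z * Zᵀ := by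
    have := (hsol.1.2.1.isHermitian.sub hfeas.2.1.isHermitian).eq
    rwa [conjTranspose_eq_transpose_of_trivial] at this
  have hcol : ∀ j, ∑ i, (Gh - Z * Zᵀ) i j = 0 := fun j => by
    rw [← hrow j, ← Finset.sum_congr rfl fun i _ => congrFun (congrFun hDsymm i) j]
    rfl
  rw [thetaMat_sub] at hbasic ⊢
  set T := thetaMat X α β (Z * Zᵀ) with hT
  have hXs : Xᵀ = X := hX.1
  have hE : (A - probMat T).IsSymm := by
    have hG : (Z * Zᵀ)ᵀ = Z * Zᵀ := by rw [transpose_mul, transpose_transpose]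
    have hTs : Tᵀ = T := by
      ext i j
      have h1 := congrFun (congrFun hXs i) j
      have h2 := congrFun (congrFun hG i) j
      simp only [transpose_apply] at h1 h2
      simp only [hT, thetaMat, transpose_apply, of_apply, h1, h2]
      ring
    ext i j
    have h1 := congrFun (congrFun hTs i) j
    have h2 := congrFun (congrFun hA.1.eq i) j
    simp only [transpose_apply] at h1 h2
    simp [probMat, h1, h2]
  set E := A - probMat T with hEdef
  set D := Gh - Z * Zᵀ with hD
  set δ := αh - α with hδ
  set b₀ := βh - β with hb₀
  set R := vecMulVec δ (fun _ : Fin n => (1 : ℝ)) with hR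
  set R' := vecMulVec (fun _ : Fin n => (1 : ℝ)) δ with hR'
  have hRR : froNorm R' = froNorm R := by
    rw [← froNorm_transpose R, hR, hR', transpose_vecMulVec]
  set g := froNorm D with hg
  set a := froNorm R with ha
  set b := |b₀| * froNorm X with hb
  set K := Real.sqrt k with hK
  have hk1 : (1 : ℝ) ≤ k := by exact_mod_cast hk
  have hK1 : 1 ≤ K := Real.one_le_sqrt.mpr hk1
  have hKsq : K ^ 2 = k := Real.sq_sqrt (by linarith)
  have hb0 : 0 ≤ b := mul_nonneg (abs_nonneg _) (froNorm_nonneg _)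
  have hg0 : 0 ≤ g := froNorm_nonneg _
  have ha0 : 0 ≤ a := froNorm_nonneg _
  have hop' : opNorm E ≤ lam / 2 := by linarith
  have hXin : |b₀ * matInner E X| ≤ K * lam * b := by
    rw [div_le_iff₀ (by linarith), matInner_smul_right, abs_mul,
      abs_of_nonneg (inv_nonneg.mpr (froNorm_nonneg X))] at hXE
    -- If the norm of `X` is zero, its inverse takes the default value zero and `hXE` is void;
    -- Cauchy–Schwarz then kills the inner product.
    rcases (froNorm_nonneg X).eq_or_lt with h0 | h0
    · have := abs_matInner_le E X
      rw [← h0, mul_zero] at this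
      rw [abs_mul, le_antisymm this (abs_nonneg _), hb, ← h0]
      simp
    · rw [inv_mul_le_iff₀ h0] at hXE
      rw [abs_mul, hb]
      calc |b₀| * |matInner E X| ≤ |b₀| * (froNorm X * (lam * K)) := by gcongr
        _ = _ := by ring
  have hcrossX : |b₀| * opNorm X ≤ b / (100 * K) := by
    by_cases hX0 : X = 0
    · have : opNorm X = 0 := by rw [hX0, opNorm, map_zero, norm_zero]
      rw [this, mul_zero]; positivity
    · have hs := hstab hX0
      rw [stableRank] at hs
      -- A vanishing spectral norm would give the stable rank the default value `0`, against its
      -- lower bound.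
      have hop0 : 0 < opNorm X := by
        rcases (opNorm_nonneg X).eq_or_lt with h0 | h0
        · rw [← h0] at hs
          simp at hs
          linarith
        · exact h0
      rw [le_div_iff₀ (by positivity), ← hKsq] at hs
      -- The stable rank constant `10000` enters as `100²`.
      have : 100 * K * opNorm X ≤ froNorm X := by
        apply le_of_sq_le_sq _ (froNorm_nonneg _)
        linarith [hs, mul_pow (100 * K) (opNorm X) 2, mul_pow 100 K 2]
      rw [le_div_iff₀ (by positivity), hb]
      nlinarith [abs_nonneg b₀]
  have hS : g ^ 2 + a ^ 2 + b ^ 2 ≤ 1536 * lam ^ 2 * K ^ 2 / Real.exp (-M₁) ^ 2 := by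
    refine error_bound_of_ineqs (D2 := froNorm (R + R' + (b₀ • X + D)) ^ 2) (t := t)
      (Real.exp_pos _) (by linarith) hK1 ha0 hb0 ht (sq_nonneg _) ?_ (by linarith) ?_
    · have h1 := (le_abs_self _).trans (htE E hE)
      have h3 := (le_abs_self _).trans (abs_matInner_vecMulVec_le E δ fun _ => 1)
      have h4 := (le_abs_self _).trans (abs_matInner_vecMulVec_le E (fun _ => 1) δ)
      rw [← hR, ← ha] at h3
      rw [← hR', hRR] at h4
      have h5 := (le_abs_self _).trans hXin
      rw [matInner_add_right, matInner_add_right, matInner_add_right, matInner_smul_right] at hbasic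
      have h6 : opNorm E * (2 * K * g + t) ≤ lam / 2 * (2 * K * g + t) :=
        mul_le_mul_of_nonneg_right hop' (by positivity)
      have h7 : opNorm E * a ≤ lam / 2 * a := mul_le_mul_of_nonneg_right hop' ha0
      have h8 : lam * (t - K * g) ≤ lam * D.trace :=
        mul_le_mul_of_nonneg_left httr (by linarith)
      linarith
    · have h1 := froNorm_sq_perturbation X D δ b₀ hrow hcol
      refine le_trans ?_ h1
      have e : b ^ 2 = b₀ ^ 2 * froNorm X ^ 2 := by rw [hb, mul_pow, sq_abs]
      rw [← hR, ← hR', ← hg, ← ha, e]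
      have h3 := abs_matInner_vecMulVec_le X δ fun _ => 1
      have h4 := abs_matInner_vecMulVec_le X (fun _ => 1) δ
      rw [← hR, ← ha] at h3
      rw [← hR', hRR] at h4
      -- The low-rank trace bound is used a second time, now with `X` in the role of the noise.
      have h5 := htE X hX.1
      have h6 : |matInner X R + matInner X R' + matInner X D| ≤
          opNorm X * (2 * K * g + t + 2 * a) :=
        (abs_add_three _ _ _).trans (by linarith)
      have h7 : |b₀ * (matInner X R + matInner X R' + matInner X D)| ≤
          b / (100 * K) * (2 * K * g + t + 2 * a) := by
        rw [abs_mul]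
        calc _ ≤ |b₀| * (opNorm X * (2 * K * g + t + 2 * a)) := by gcongr
          _ = (|b₀| * opNorm X) * (2 * K * g + t + 2 * a) := by ring
          _ ≤ _ := by gcongr
      have h8 := neg_le_of_abs_le h7
      have h9 : b / (50 * K) = 2 * (b / (100 * K)) := by ring
      rw [h9]
      linarith
  have hexp : (1 : ℝ) / Real.exp (-M₁) ^ 2 = Real.exp (2 * M₁) := by
    rw [← Real.exp_nat_mul, one_div, ← Real.exp_neg]
    congr 1; push_cast; ring
  have hS' : g ^ 2 + a ^ 2 + b ^ 2 ≤ 1536 * (Real.exp (2 * M₁) * lam ^ 2 * k) := by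
    rw [div_eq_mul_one_div, hexp, hKsq] at hS
    linarith
  have hpos : 0 ≤ Real.exp (2 * M₁) * lam ^ 2 * k := by positivity
  refine ⟨by nlinarith [sq_nonneg a, sq_nonneg b], ?_⟩
  -- Squaring costs `6 = 1² + 2² + 1²` by Cauchy–Schwarz, whence `9216 = 6 * 1536`.
  have hle : froNorm (R + R' + (b₀ • X + D)) ≤ g + 2 * a + b := by
    have h1 := froNorm_add_le (R + R') (b₀ • X + D)
    have h2 := froNorm_add_le R R'
    have h3 := froNorm_add_le (b₀ • X) D
    rw [froNorm_smul] at h3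
    linarith
  have := pow_le_pow_left₀ (froNorm_nonneg _) hle 2
  nlinarith [sq_nonneg (2 * g - a), sq_nonneg (a - 2 * b), sq_nonneg (g - b)]

end LatentSpace

/-! ### Closed walks and the comparison of walk counts. -/

namespace LatentSpace

open Matrix

section Walks

variable {N : ℕ} {V W : Type*}

/-- The unordered edge traversed at time `t` by the walk `u`. -/
def step (u : Fin (N + 1) → V) (t : Fin N) : Sym2 V := s(u t.castSucc, u t.succ)

/-- Closed walks without loops that traverse each of their edges at least twice. -/
def IsDoubled (u : Fin (N + 1) → V) : Prop :=
  u 0 = u (Fin.last N) ∧ (∀ t : Fin N, u t.castSucc ≠ u t.succ) ∧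
    ∀ t, ∃ t', t' ≠ t ∧ step u t' = step u t

/-- The set of edges traversed by a walk. -/
def walkEdges [DecidableEq V] (u : Fin (N + 1) → V) : Finset (Sym2 V) :=
  Finset.univ.image (step u)

/-- Entries of matrix powers as sums over walks. -/
lemma pow_apply_eq_sum_walks [Fintype V] [DecidableEq V] (M : Matrix V V ℝ) (N : ℕ) (i j : V) :
    (M ^ N) i j = ∑ u : Fin (N + 1) → V, if u 0 = i ∧ u (Fin.last N) = j then
      ∏ t : Fin N, M (u t.castSucc) (u t.succ) else 0 := by
  induction N generalizing i with
  | zero =>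
    rw [← (Equiv.funUnique (Fin 1) V).symm.sum_comp]
    rw [Finset.sum_eq_single i]
    · simp [one_apply]
    · intro b _ hb; simp [hb]
    · simp
  | succ N ih =>
    rw [pow_succ', mul_apply, ← (Fin.consEquiv fun _ => V).sum_comp, Fintype.sum_prod_type]
    simp only [ih, Finset.mul_sum]
    rw [Finset.sum_comm, Finset.sum_comm (γ := V)]
    refine Finset.sum_congr rfl fun u _ => ?_
    simp only [Fin.consEquiv_apply, Fin.cons_zero, ← Fin.succ_last, Fin.cons_succ,
      Fin.prod_univ_succ, Fin.castSucc_zero, ← Fin.succ_castSucc]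
    rw [Finset.sum_eq_single (u 0), Finset.sum_eq_single i]
    · simp
    · intro b _ hb; simp [hb]
    · simp
    · intro b _ hb; simp [hb.symm]
    · simp

lemma trace_pow_eq_sum_walks [Fintype V] [DecidableEq V] (M : Matrix V V ℝ) (N : ℕ) :
    (M ^ N).trace = ∑ u : Fin (N + 1) → V, if u 0 = u (Fin.last N) then
      ∏ t : Fin N, M (u t.castSucc) (u t.succ) else 0 := by
  simp only [trace, diag_apply, pow_apply_eq_sum_walks]
  rw [Finset.sum_comm]
  refine Finset.sum_congr rfl fun u _ => ?_
  rw [Finset.sum_eq_single (u 0)]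
  · simp [eq_comm]
  · intro b _ hb; simp [hb.symm]
  · simp

/-- The edges of a walk form a connected graph. Inductively, a last vertex not seen before forces
the last edge to be new. -/
lemma card_image_le_card_walkEdges [DecidableEq V] (u : Fin (N + 1) → V) :
    (Finset.univ.image u).card ≤ (walkEdges u).card + 1 := by
  induction N with
  | zero => exact Finset.card_image_le.trans (by simp)
  | succ N ih =>
    have h := ih (u ∘ Fin.castSucc)
    have h1 : Finset.univ.image u =
        insert (u (Fin.last _)) (Finset.univ.image (u ∘ Fin.castSucc)) := by
      rw [Fin.univ_castSuccEmb, Finset.cons_eq_insert, Finset.image_insert, Finset.map_eq_image,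
        Finset.image_image]
      rfl
    have h2 : walkEdges u = insert (step u (Fin.last N)) (walkEdges (u ∘ Fin.castSucc)) := by
      rw [walkEdges, Fin.univ_castSuccEmb, Finset.cons_eq_insert, Finset.image_insert,
        Finset.map_eq_image, Finset.image_image]
      rfl
    rw [h1, h2]
    by_cases hmem : u (Fin.last _) ∈ Finset.univ.image (u ∘ Fin.castSucc)
    · rw [Finset.insert_eq_of_mem hmem]
      exact h.trans (Nat.add_le_add_right (Finset.card_le_card (Finset.subset_insert _ _)) 1)
    · have hmem2 : step u (Fin.last N) ∉ walkEdges (u ∘ Fin.castSucc) := by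
        intro hc
        obtain ⟨t, -, ht⟩ := Finset.mem_image.mp hc
        apply hmem
        have : u (Fin.last N).succ ∈ step (u ∘ Fin.castSucc) t := by
          rw [ht]; exact Sym2.mem_mk_right _ _
        rcases Sym2.mem_iff.mp this with h | h
        · exact Finset.mem_image.mpr ⟨_, Finset.mem_univ _, h.symm⟩
        · exact Finset.mem_image.mpr ⟨_, Finset.mem_univ _, h.symm⟩
      rw [Finset.card_insert_of_notMem hmem, Finset.card_insert_of_notMem hmem2]
      omega

lemma IsDoubled.two_mul_card_walkEdges_le [DecidableEq V] {u : Fin (N + 1) → V}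
    (h : IsDoubled u) : 2 * (walkEdges u).card ≤ N := by
  have h1 := Finset.card_nsmul_le_sum (walkEdges u)
    (fun b => (Finset.univ.filter fun t => step u t = b).card) 2 fun b hb => by
      obtain ⟨t, -, rfl⟩ := Finset.mem_image.mp hb
      obtain ⟨t', h1, h2⟩ := h.2.2 t
      exact Finset.one_lt_card.mpr ⟨t', by simp [h2], t, by simp, h1⟩
  rw [walkEdges, ← Finset.card_eq_sum_card_image, Finset.card_univ, Fintype.card_fin,
    smul_eq_mul] at h1
  rw [walkEdges]; omega

/-- Being doubled depends only on which times share a vertex, so it can be transferred between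
vertex sets of different sizes. -/
lemma isDoubled_iff_of_ker_eq {u : Fin (N + 1) → V} {w : Fin (N + 1) → W}
    (h : Setoid.ker u = Setoid.ker w) : IsDoubled u ↔ IsDoubled w := by
  have h' : ∀ a b, u a = u b ↔ w a = w b := fun a b => by
    rw [← Setoid.ker_def (f := u), ← Setoid.ker_def (f := w), h]
  simp only [IsDoubled, step, Sym2.eq_iff, h', ne_eq]

open Classical in
-- A walk with pattern `π` is determined by its values at one representative of each class.
lemma card_filter_ker_eq_le [Fintype V] (π : Setoid (Fin (N + 1))) :
    (Finset.univ.filter fun u : Fin (N + 1) → V => Setoid.ker u = π).card ≤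
      Fintype.card V ^ Fintype.card (Quotient π) := by
  rw [← Fintype.card_fun]
  refine Finset.card_le_card_of_injOn
    (fun u q => u q.out) (fun _ _ => Finset.mem_coe.2 (Finset.mem_univ _)) ?_
  intro u hu w hw huw
  simp only [Finset.coe_filter, Finset.mem_univ, true_and, Set.mem_ofPred_eq] at hu hw
  funext a
  have h1 : π (Quotient.mk π a).out a := Quotient.mk_out a
  have h2 := congrFun huw (Quotient.mk π a)
  have h3 : u (Quotient.mk π a).out = u a := by rw [← Setoid.ker_def, hu]; exact h1
  have h4 : w (Quotient.mk π a).out = w a := by rw [← Setoid.ker_def, hw]; exact h1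
  rw [← h3, ← h4]; exact h2

open Classical in
-- Each injective labelling of the classes yields a walk whose pattern is exactly `π`.
lemma descFactorial_le_card_filter_ker_eq [Fintype V] (π : Setoid (Fin (N + 1))) :
    (Fintype.card V).descFactorial (Fintype.card (Quotient π)) ≤
      (Finset.univ.filter fun u : Fin (N + 1) → V => Setoid.ker u = π).card := by
  rw [← Fintype.card_embedding_eq, ← Finset.card_univ]
  refine Finset.card_le_card_of_injOn
    (fun (f : Quotient π ↪ V) a => f (Quotient.mk π a)) ?_ ?_
  · intro f _
    simp only [Finset.coe_filter, Finset.mem_univ, true_and, Set.mem_ofPred_eq]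
    ext a b
    rw [Setoid.ker_def, f.injective.eq_iff]
    exact Quotient.eq
  · intro f _ g _ hfg
    ext q
    induction q using Quotient.inductionOn with
    | h a => exact congrFun hfg a

open Classical in
lemma card_image_eq_card_quotient_ker (u : Fin (N + 1) → V) :
    (Finset.univ.image u).card = Fintype.card (Quotient (Setoid.ker u)) := by
  rw [← Fintype.card_coe]
  refine Fintype.card_congr (Equiv.trans ?_ (Setoid.quotientKerEquivRange u).symm)
  exact Equiv.subtypeEquivRight fun x => by simp

open Classical in
/-- Comparison of the numbers of doubled closed walks in a sparse and in a dense model. -/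
lemma sum_doubled_pow_card_le (n m : ℕ) (hm : 1 ≤ m) {p : ℝ} (hp : 0 ≤ p) (hp1 : p ≤ 1)
    (hnp : n * p ≤ m) (hN : N ≤ 2 * m) :
    (∑ u : Fin (N + 1) → Fin n, if IsDoubled u then p ^ (walkEdges u).card else 0) * (2 * m : ℕ)
      ≤ n * ((Finset.univ.filter fun w : Fin (N + 1) → Fin (2 * m) => IsDoubled w).card : ℝ) := by
  let _ : Fintype (Setoid (Fin (N + 1))) :=
    Fintype.ofInjective (fun s a b => (s a b : Prop)) fun s s' h => by
      ext a b; exact iff_of_eq (congrFun (congrFun h a) b)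
  have hR : ((Finset.univ.filter fun w : Fin (N + 1) → Fin (2 * m) => IsDoubled w).card : ℝ)
      = ∑ π : Setoid (Fin (N + 1)), ((Finset.univ.filter fun w : Fin (N + 1) → Fin (2 * m) =>
        IsDoubled w ∧ Setoid.ker w = π).card : ℝ) := by
    rw [Finset.card_eq_sum_card_fiberwise (f := Setoid.ker) (t := Finset.univ)
      (fun _ _ => Finset.mem_coe.2 (Finset.mem_univ _))]
    simp [Finset.filter_filter]
  rw [hR, ← Finset.sum_fiberwise Finset.univ Setoid.ker, Finset.sum_mul, Finset.mul_sum]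
  refine Finset.sum_le_sum fun π _ => ?_
  by_cases hπ : ∃ u : Fin (N + 1) → Fin n, Setoid.ker u = π ∧ IsDoubled u
  · obtain ⟨u₀, rfl, hu₀⟩ := hπ
    set π := Setoid.ker u₀
    -- The pattern has `q + 1` vertices, hence at least `q` edges, and doubling bounds the number of
    -- edges by `m`.
    obtain ⟨q, hq⟩ : ∃ q, Fintype.card (Quotient π) = q + 1 :=
      Nat.exists_eq_succ_of_ne_zero (Fintype.card_pos_iff.mpr ⟨Quotient.mk π 0⟩).ne'
    have hqe : ∀ u : Fin (N + 1) → Fin n, Setoid.ker u = π → q ≤ (walkEdges u).card := fun u hu => by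
      have h1 := card_image_le_card_walkEdges u
      have h2 := card_image_eq_card_quotient_ker u
      have h3 : Fintype.card (Quotient (Setoid.ker u)) = q + 1 := by rw [← hq]; congr!
      have h4 : (Finset.univ.image u).card = q + 1 := by rw [← h3, ← h2]; congr!
      omega
    have hqm : q ≤ m := by
      have h1 := hqe u₀ rfl
      have h2 := hu₀.two_mul_card_walkEdges_le
      omega
    have hL : (∑ u : Fin (N + 1) → Fin n with Setoid.ker u = π,
        if IsDoubled u then p ^ (walkEdges u).card else 0)
        ≤ (n : ℝ) ^ (q + 1) * p ^ q := by
      calc _ ≤ ∑ u : Fin (N + 1) → Fin n with Setoid.ker u = π, p ^ q := by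
            refine Finset.sum_le_sum fun u hu => ?_
            split_ifs
            · exact pow_le_pow_of_le_one hp hp1 (hqe u (by simpa using hu))
            · positivity
        _ ≤ _ := by
            rw [Finset.sum_const, nsmul_eq_mul]
            gcongr
            have := card_filter_ker_eq_le (V := Fin n) π
            rw [hq, Fintype.card_fin] at this
            exact_mod_cast this
    have hcard : (2 * m) * m ^ q ≤ (Finset.univ.filter fun w : Fin (N + 1) → Fin (2 * m) =>
        IsDoubled w ∧ Setoid.ker w = π).card := by
      have h1 := descFactorial_le_card_filter_ker_eq (V := Fin (2 * m)) π
      rw [hq, Fintype.card_fin] at h1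
      have h2 : (Finset.univ.filter fun w : Fin (N + 1) → Fin (2 * m) => Setoid.ker w = π)
          = Finset.univ.filter fun w : Fin (N + 1) → Fin (2 * m) =>
            IsDoubled w ∧ Setoid.ker w = π := by
        refine Finset.filter_congr fun w _ => ⟨fun hw => ⟨?_, hw⟩, fun hw => hw.2⟩
        exact (isDoubled_iff_of_ker_eq hw).mpr hu₀
      rw [← h2]
      refine le_trans ?_ h1
      -- The falling factorial is `2 * m` times `q` factors, each at least `2 * m - q ≥ m`; this is
      -- why the comparison uses `2 * m` vertices.
      obtain ⟨r, hr⟩ : ∃ r, 2 * m = r + 1 := ⟨2 * m - 1, by omega⟩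
      rw [hr, Nat.succ_descFactorial_succ]
      refine Nat.mul_le_mul_left _ (le_trans (Nat.pow_le_pow_left ?_ q)
        (Nat.pow_sub_le_descFactorial r q))
      omega
    calc _ ≤ (n : ℝ) ^ (q + 1) * p ^ q * (2 * m : ℕ) := by gcongr
      _ = n * ((2 * m : ℕ) * (n * p) ^ q) := by rw [mul_pow]; ring
      _ ≤ n * ((2 * m : ℕ) * (m : ℝ) ^ q) := by gcongr
      _ ≤ _ := by
          gcongr
          exact_mod_cast hcard
  · push Not at hπ
    rw [Finset.sum_eq_zero fun u hu => if_neg (hπ u (by simpa using hu)), zero_mul]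
    positivity

end Walks

end LatentSpace

/-! ### Trace moments of random symmetric matrices with independent entries. -/

namespace LatentSpace

open Matrix

section RandomSymmetric

variable {n N : ℕ}

/-- Index pairs strictly above the diagonal. -/
abbrev UpperPair (n : ℕ) := {e : Fin n × Fin n // e.1 < e.2}

/-- The symmetric matrix with zero diagonal and given entries above the diagonal. -/
def symMat (x : UpperPair n → ℝ) : Matrix (Fin n) (Fin n) ℝ :=
  of fun i j => if h : i < j then x ⟨(i, j), h⟩ else if h : j < i then x ⟨(j, i), h⟩ else 0

/-- The unordered pair underlying `e`. -/
def UpperPair.toSym2 (e : UpperPair n) : Sym2 (Fin n) := s(e.1.1, e.1.2)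

lemma UpperPair.toSym2_injective : Function.Injective (UpperPair.toSym2 (n := n)) := by
  rintro ⟨⟨a, b⟩, h⟩ ⟨⟨c, d⟩, h'⟩ heq
  simp only [UpperPair.toSym2, Sym2.eq_iff] at heq
  simp only at h h'
  rcases heq with ⟨rfl, rfl⟩ | ⟨rfl, rfl⟩
  · rfl
  · exact absurd h (lt_asymm h')

lemma UpperPair.exists_toSym2_eq {i j : Fin n} (h : i ≠ j) :
    ∃ e : UpperPair n, e.toSym2 = s(i, j) := by
  rcases lt_or_gt_of_ne h with h | h
  · exact ⟨⟨(i, j), h⟩, rfl⟩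
  · exact ⟨⟨(j, i), h⟩, Sym2.eq_swap⟩

lemma symMat_transpose (x : UpperPair n → ℝ) : (symMat x)ᵀ = symMat x := by
  ext i j
  simp only [symMat, transpose_apply, of_apply]
  rcases lt_trichotomy i j with h | h | h
  · simp [h, h.not_gt]
  · simp [h]
  · simp [h, h.not_gt]

lemma symMat_self (x : UpperPair n → ℝ) (i : Fin n) : symMat x i i = 0 := by simp [symMat]

lemma symMat_apply_of_toSym2_eq (x : UpperPair n → ℝ) {i j : Fin n} {e : UpperPair n}
    (h : e.toSym2 = s(i, j)) : symMat x i j = x e := by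
  obtain ⟨⟨a, b⟩, hab⟩ := e
  simp only at hab
  rcases Sym2.eq_iff.mp h with ⟨h1, h2⟩ | ⟨h1, h2⟩
  · simp only at h1 h2; subst h1 h2; simp [symMat, hab]
  · simp only at h1 h2; subst h1 h2; simp [symMat, hab, hab.not_gt]

/-- The number of times that the walk `u` traverses `e`. -/
def multiplicity (u : Fin (N + 1) → Fin n) (e : UpperPair n) : ℕ :=
  (Finset.univ.filter fun t => step u t = e.toSym2).card

/-- Collecting equal edges turns the walk product into powers of distinct independent variables, so
that expectations factor. -/
lemma prod_symMat_eq (x : UpperPair n → ℝ) {u : Fin (N + 1) → Fin n}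
    (hu : ∀ t : Fin N, u t.castSucc ≠ u t.succ) :
    ∏ t : Fin N, symMat x (u t.castSucc) (u t.succ) = ∏ e, x e ^ multiplicity u e := by
  have h1 : ∀ t : Fin N, symMat x (u t.castSucc) (u t.succ) =
      ∏ e : UpperPair n, if step u t = e.toSym2 then x e else 1 := fun t => by
    obtain ⟨e, he⟩ := UpperPair.exists_toSym2_eq (hu t)
    rw [symMat_apply_of_toSym2_eq x he, Finset.prod_eq_single e]
    · exact (if_pos he.symm).symm
    · intro e' _ hne
      exact if_neg fun h => hne (UpperPair.toSym2_injective (h.symm.trans he.symm))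
    · simp
  simp only [h1]
  rw [Finset.prod_comm]
  refine Finset.prod_congr rfl fun e _ => ?_
  rw [Finset.prod_ite, Finset.prod_const, Finset.prod_const_one, mul_one, multiplicity]

lemma prod_symMat_eq_zero (x : UpperPair n → ℝ) {u : Fin (N + 1) → Fin n}
    (hu : ¬ ∀ t : Fin N, u t.castSucc ≠ u t.succ) :
    ∏ t : Fin N, symMat x (u t.castSucc) (u t.succ) = 0 := by
  push Not at hu
  obtain ⟨t, ht⟩ := hu
  exact Finset.prod_eq_zero (Finset.mem_univ t) (by rw [ht, symMat_self])

lemma IsDoubled.multiplicity_ne_one {u : Fin (N + 1) → Fin n} (hu : IsDoubled u)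
    (e : UpperPair n) : multiplicity u e ≠ 1 := by
  intro h
  obtain ⟨t, ht⟩ := Finset.card_eq_one.mp h
  have h1 : step u t = e.toSym2 := by
    have : t ∈ Finset.univ.filter fun t => step u t = e.toSym2 := by rw [ht]; simp
    simpa using this
  obtain ⟨t', hne, ht'⟩ := hu.2.2 t
  have : t' ∈ Finset.univ.filter fun t => step u t = e.toSym2 := by simp [ht', h1]
  rw [ht] at this
  exact hne (by simpa using this)

lemma exists_multiplicity_eq_one {u : Fin (N + 1) → Fin n} (hc : u 0 = u (Fin.last N))
    (hl : ∀ t : Fin N, u t.castSucc ≠ u t.succ) (hu : ¬ IsDoubled u) :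
    ∃ e, multiplicity u e = 1 := by
  have : ∃ t, ∀ t', t' ≠ t → step u t' ≠ step u t := by
    by_contra! h
    exact hu ⟨hc, hl, h⟩
  obtain ⟨t, ht⟩ := this
  obtain ⟨e, he⟩ := UpperPair.exists_toSym2_eq (hl t)
  refine ⟨e, Finset.card_eq_one.mpr ⟨t, ?_⟩⟩
  ext t'
  simp only [Finset.mem_filter, Finset.mem_univ, true_and, Finset.mem_singleton]
  constructor
  · intro h
    by_contra hne
    exact ht t' hne (h.trans he)
  · rintro rfl; exact he.symm

lemma card_walkEdges_le {u : Fin (N + 1) → Fin n} (hl : ∀ t : Fin N, u t.castSucc ≠ u t.succ) :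
    (walkEdges u).card ≤ (Finset.univ.filter fun e => multiplicity u e ≠ 0).card := by
  refine le_trans (Finset.card_le_card ?_)
    (Finset.card_image_le (f := UpperPair.toSym2) (s := Finset.univ.filter fun e =>
      multiplicity u e ≠ 0))
  intro b hb
  obtain ⟨t, -, rfl⟩ := Finset.mem_image.mp hb
  obtain ⟨e, he⟩ := UpperPair.exists_toSym2_eq (hl t)
  refine Finset.mem_image.mpr ⟨e, ?_, he⟩
  rw [Finset.mem_filter]
  refine ⟨Finset.mem_univ _, ?_⟩
  exact Finset.card_ne_zero_of_mem (Finset.mem_filter.mpr ⟨Finset.mem_univ t, he.symm⟩)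

variable {Ω : Type*} [MeasurableSpace Ω] {μ : Measure Ω} [IsProbabilityMeasure μ]
  {ξ : UpperPair n → Ω → ℝ}

lemma measurable_symMat (hm : ∀ e, Measurable (ξ e)) (i j : Fin n) :
    Measurable fun ω => symMat (fun e => ξ e ω) i j := by
  simp only [symMat, of_apply]
  split_ifs <;> first | exact hm _ | exact measurable_const

lemma abs_symMat_le {x : UpperPair n → ℝ} {B : ℝ} (hB : 0 ≤ B) (hx : ∀ e, |x e| ≤ B)
    (i j : Fin n) : |symMat x i j| ≤ B := by
  simp only [symMat, of_apply]
  split_ifs <;> first | exact hx _ | simpa using hB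

lemma integrable_prod_symMat (hm : ∀ e, Measurable (ξ e)) {B : ℝ} (hB : 0 ≤ B)
    (hb : ∀ e ω, |ξ e ω| ≤ B) (u : Fin (N + 1) → Fin n) :
    Integrable (fun ω => ∏ t : Fin N, symMat (fun e => ξ e ω) (u t.castSucc) (u t.succ)) μ := by
  refine Integrable.of_bound (C := ∏ _t : Fin N, B)
    (Finset.measurable_prod _ fun t _ => measurable_symMat hm _ _).aestronglyMeasurable
    (ae_of_all _ fun ω => ?_)
  rw [norm_prod]
  exact Finset.prod_le_prod (fun _ _ => norm_nonneg _)
    fun t _ => abs_symMat_le hB (fun e => hb e ω) _ _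

lemma integral_trace_symMat_pow (hm : ∀ e, Measurable (ξ e)) {B : ℝ} (hB : 0 ≤ B)
    (hb : ∀ e ω, |ξ e ω| ≤ B) (N : ℕ) :
    ∫ ω, ((symMat fun e => ξ e ω) ^ N).trace ∂μ = ∑ u : Fin (N + 1) → Fin n,
      if u 0 = u (Fin.last N) then
        ∫ ω, ∏ t : Fin N, symMat (fun e => ξ e ω) (u t.castSucc) (u t.succ) ∂μ else 0 := by
  simp only [trace_pow_eq_sum_walks]
  rw [integral_finsetSum]
  · refine Finset.sum_congr rfl fun u _ => ?_
    split_ifs <;> simp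
  · intro u _
    split_ifs
    · exact integrable_prod_symMat hm hB hb u
    · exact integrable_zero _ _ _

lemma integrable_trace_symMat_pow (hm : ∀ e, Measurable (ξ e)) {B : ℝ} (hB : 0 ≤ B)
    (hb : ∀ e ω, |ξ e ω| ≤ B) (N : ℕ) :
    Integrable (fun ω => ((symMat fun e => ξ e ω) ^ N).trace) μ := by
  simp only [trace_pow_eq_sum_walks]
  refine integrable_finsetSum _ fun u _ => ?_
  split_ifs
  · exact integrable_prod_symMat hm hB hb u
  · exact integrable_zero _ _ _

omit [IsProbabilityMeasure μ] in
lemma integral_prod_symMat (hm : ∀ e, Measurable (ξ e)) (hi : iIndepFun ξ μ)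
    {u : Fin (N + 1) → Fin n} (hu : ∀ t : Fin N, u t.castSucc ≠ u t.succ) :
    ∫ ω, ∏ t : Fin N, symMat (fun e => ξ e ω) (u t.castSucc) (u t.succ) ∂μ =
      ∏ e, ∫ ω, ξ e ω ^ multiplicity u e ∂μ := by
  simp only [prod_symMat_eq _ hu]
  exact hi.integral_fun_prod_comp (f := fun e x => x ^ multiplicity u e)
    (fun e => (hm e).aemeasurable) fun e => (measurable_id.pow_const _).aestronglyMeasurable

open Classical in
/-- Trace moments of a centered symmetric matrix with small variances. -/
lemma integral_trace_symMat_pow_le (hm : ∀ e, Measurable (ξ e)) (hi : iIndepFun ξ μ) {p : ℝ}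
    (hp : 0 ≤ p) (hp1 : p ≤ 1) (hb : ∀ e ω, |ξ e ω| ≤ 1) (h0 : ∀ e, ∫ ω, ξ e ω ∂μ = 0)
    (hpow : ∀ e k, 2 ≤ k → |∫ ω, ξ e ω ^ k ∂μ| ≤ p) (N : ℕ) :
    ∫ ω, ((symMat fun e => ξ e ω) ^ N).trace ∂μ ≤
      ∑ u : Fin (N + 1) → Fin n, if IsDoubled u then p ^ (walkEdges u).card else 0 := by
  rw [integral_trace_symMat_pow hm zero_le_one hb]
  refine Finset.sum_le_sum fun u _ => ?_
  by_cases hc : u 0 = u (Fin.last N)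
  swap
  · rw [if_neg hc]; split_ifs <;> positivity
  rw [if_pos hc]
  by_cases hl : ∀ t : Fin N, u t.castSucc ≠ u t.succ
  swap
  · simp only [prod_symMat_eq_zero _ hl, integral_zero]; split_ifs <;> positivity
  rw [integral_prod_symMat hm hi hl]
  by_cases hu : IsDoubled u
  · rw [if_pos hu]
    refine (le_abs_self _).trans ?_
    rw [Finset.abs_prod]
    -- Every edge used contributes at most `p`, whatever its multiplicity, which is never `1`.
    calc ∏ e, |∫ ω, ξ e ω ^ multiplicity u e ∂μ|
        ≤ ∏ e : UpperPair n, (if multiplicity u e ≠ 0 then p else 1) := by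
          refine Finset.prod_le_prod (fun _ _ => abs_nonneg _) fun e _ => ?_
          split_ifs with h
          · exact hpow e _ (by have := hu.multiplicity_ne_one e; omega)
          · have h' : multiplicity u e = 0 := by simpa using h
            simp [h']
      _ = p ^ (Finset.univ.filter fun e => multiplicity u e ≠ 0).card := by
          rw [Finset.prod_ite, Finset.prod_const, Finset.prod_const_one, mul_one]
      _ ≤ _ := pow_le_pow_of_le_one hp hp1 (card_walkEdges_le hl)
  -- An edge used exactly once contributes its mean, which is zero.
  · obtain ⟨e, he⟩ := exists_multiplicity_eq_one hc hl hu
    rw [if_neg hu, Finset.prod_eq_zero (Finset.mem_univ e) (by rw [he]; simpa using h0 e)]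

open Classical in
/-- Trace moments dominate the number of doubled closed walks if the entries are centered and
their higher moments are at least one. -/
lemma card_isDoubled_le_integral_trace (hm : ∀ e, Measurable (ξ e)) (hi : iIndepFun ξ μ) {B : ℝ}
    (hB : 0 ≤ B) (hb : ∀ e ω, |ξ e ω| ≤ B) (h0 : ∀ e, ∫ ω, ξ e ω ∂μ = 0)
    (hpow : ∀ e k, 2 ≤ k → 1 ≤ ∫ ω, ξ e ω ^ k ∂μ) (N : ℕ) :
    ((Finset.univ.filter fun u : Fin (N + 1) → Fin n => IsDoubled u).card : ℝ) ≤
      ∫ ω, ((symMat fun e => ξ e ω) ^ N).trace ∂μ := by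
  rw [integral_trace_symMat_pow hm hB hb, Finset.card_filter]
  push_cast
  refine Finset.sum_le_sum fun u _ => ?_
  by_cases hu : IsDoubled u
  · rw [if_pos hu, if_pos hu.1, integral_prod_symMat hm hi hu.2.1]
    rw [← Finset.prod_const_one (s := (Finset.univ : Finset (UpperPair n)))]
    refine Finset.prod_le_prod (fun _ _ => zero_le_one) fun e _ => ?_
    rcases Nat.eq_zero_or_pos (multiplicity u e) with h | h
    · simp [h]
    · exact hpow e _ (by have := hu.multiplicity_ne_one e; omega)
  rw [if_neg hu]
  split_ifs with hc
  · by_cases hl : ∀ t : Fin N, u t.castSucc ≠ u t.succ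
    · obtain ⟨e, he⟩ := exists_multiplicity_eq_one hc hl hu
      rw [integral_prod_symMat hm hi hl,
        Finset.prod_eq_zero (Finset.mem_univ e) (by rw [he]; simpa using h0 e)]
    · simp only [prod_symMat_eq_zero _ hl, integral_zero, le_refl]
  · rfl

end RandomSymmetric

end LatentSpace

/-! ### Operator norms through traces, quadratic forms and sub-Gaussian moments. -/

namespace LatentSpace

open Matrix

section NormMoments

variable {n : ℕ}

lemma abs_diag_le_opNorm (M : Matrix (Fin n) (Fin n) ℝ) (i : Fin n) : |M i i| ≤ opNorm M := by
  apply abs_le_of_sq_le_sq _ (opNorm_nonneg _)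
  have h := sum_mulVec_sq_le M (Pi.single i 1)
  have h1 : ∑ j, (Pi.single i (1 : ℝ) : Fin n → ℝ) j ^ 2 = 1 := by
    rw [Finset.sum_eq_single i] <;> simp +contextual
  rw [h1, mul_one] at h
  refine le_trans ?_ h
  have h2 := Finset.single_le_sum (f := fun j => (M *ᵥ Pi.single i 1) j ^ 2)
    (fun j _ => sq_nonneg _) (Finset.mem_univ i)
  simpa using h2

lemma trace_pow_le (M : Matrix (Fin n) (Fin n) ℝ) {N : ℕ} (hN : 0 < N) :
    (M ^ N).trace ≤ n * opNorm M ^ N := by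
  have h1 : opNorm (M ^ N) ≤ opNorm M ^ N := by
    rw [opNorm, map_pow]; exact norm_pow_le' _ hN
  calc (M ^ N).trace ≤ ∑ _i : Fin n, opNorm M ^ N :=
        Finset.sum_le_sum fun i _ => ((le_abs_self _).trans (abs_diag_le_opNorm _ i)).trans h1
    _ = _ := by simp

lemma isSelfAdjoint_toEuclideanCLM {M : Matrix (Fin n) (Fin n) ℝ} (hM : Mᵀ = M) :
    IsSelfAdjoint (Matrix.toEuclideanCLM (n := Fin n) (𝕜 := ℝ) M) := by
  rw [IsSelfAdjoint, ← map_star, star_eq_conjTranspose, conjTranspose_eq_transpose_of_trivial, hM]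

/-- The squared spectral norm of `M ^ 2 ^ s` is at most its squared Frobenius norm, which is this
trace. The exponent is a power of two because the norm identity for self-adjoint operators comes
from repeated squaring. -/
lemma opNorm_pow_le_trace {M : Matrix (Fin n) (Fin n) ℝ} (hM : Mᵀ = M) (s : ℕ) :
    opNorm M ^ (2 * 2 ^ s) ≤ (M ^ (2 * 2 ^ s)).trace := by
  have h1 : opNorm (M ^ 2 ^ s) = opNorm M ^ 2 ^ s := by
    rw [opNorm, map_pow, (isSelfAdjoint_toEuclideanCLM hM).norm_pow_two_pow, opNorm]
  rw [mul_comm, pow_mul, ← h1]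
  refine (pow_le_pow_left₀ (opNorm_nonneg _) (opNorm_le_froNorm _) 2).trans (le_of_eq ?_)
  rw [← matInner_self, matInner_eq_trace, transpose_pow, hM, pow_mul, sq]

/-- For a symmetric matrix the norm is the supremum of the Rayleigh quotient. The factor `3/4`
leaves room for the loss `3/8` in `abs_inner_sub_le`. -/
lemma exists_unit_opNorm_le {M : Matrix (Fin n) (Fin n) ℝ} (hM : Mᵀ = M) (h0 : 0 < opNorm M) :
    ∃ v : EuclideanSpace ℝ (Fin n), ‖v‖ = 1 ∧
      3 / 4 * opNorm M ≤ |inner ℝ (Matrix.toEuclideanCLM (n := Fin n) (𝕜 := ℝ) M v) v| := by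
  set T := Matrix.toEuclideanCLM (n := Fin n) (𝕜 := ℝ) M with hT
  have hsymm : (T : EuclideanSpace ℝ (Fin n) →ₗ[ℝ] EuclideanSpace ℝ (Fin n)).IsSymmetric :=
    (isSelfAdjoint_toEuclideanCLM hM).isSymmetric
  have h1 := T.norm_eq_iSup_rayleighQuotient hsymm
  have h2 : 3 / 4 * opNorm M < ⨆ x, |T.rayleighQuotient x| := by
    rw [← h1]
    change 3 / 4 * opNorm M < opNorm M
    linarith
  obtain ⟨x, hx⟩ := exists_lt_of_lt_ciSup h2
  have hx0 : x ≠ 0 := by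
    rintro rfl
    simp at hx
    linarith
  have hxn : ‖x‖ ≠ 0 := norm_ne_zero_iff.mpr hx0
  refine ⟨‖x‖⁻¹ • x, by rw [norm_smul, norm_inv, norm_norm, inv_mul_cancel₀ hxn], ?_⟩
  refine hx.le.trans (le_of_eq ?_)
  rw [map_smul, real_inner_smul_left, real_inner_smul_right, ContinuousLinearMap.rayleighQuotient,
    ContinuousLinearMap.reApplyInnerSelf_apply]
  congr 1
  simp only [RCLike.re_to_real]
  field_simp

/-- Quadratic forms near a unit vector are close to their value there. -/
lemma abs_inner_sub_le {T : EuclideanSpace ℝ (Fin n) →L[ℝ] EuclideanSpace ℝ (Fin n)}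
    {v x : EuclideanSpace ℝ (Fin n)} (hv : ‖v‖ = 1) (hx : ‖x - v‖ ≤ 1 / 8) :
    |inner ℝ (T x) x - inner ℝ (T v) v| ≤ 3 / 8 * ‖T‖ := by
  have hxn : ‖x‖ ≤ 9 / 8 := by
    have := norm_add_le (x - v) v
    rw [sub_add_cancel] at this
    linarith
  have e : inner ℝ (T x) x - inner ℝ (T v) v = inner ℝ (T (x - v)) x + inner ℝ (T v) (x - v) := by
    rw [map_sub, inner_sub_left, inner_sub_right]; ring
  have h1 : |inner ℝ (T (x - v)) x| ≤ ‖T‖ * (1 / 8) * (9 / 8) :=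
    (abs_real_inner_le_norm _ _).trans (mul_le_mul ((T.le_opNorm _).trans
      (mul_le_mul_of_nonneg_left hx (norm_nonneg _))) hxn (norm_nonneg _) (by positivity))
  have h2 : |inner ℝ (T v) (x - v)| ≤ ‖T‖ * 1 * (1 / 8) :=
    (abs_real_inner_le_norm _ _).trans (mul_le_mul ((T.le_opNorm _).trans
      (mul_le_mul_of_nonneg_left hv.le (norm_nonneg _))) hx (norm_nonneg _) (by positivity))
  rw [e]
  have := norm_nonneg T
  have h3 := abs_add_le (inner ℝ (T (x - v)) x) (inner ℝ (T v) (x - v))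
  linarith

/-- Powers of the operator norm are dominated by averages of powers of the quadratic form over a
ball. -/
lemma opNorm_pow_mul_volume_le [NeZero n] {M : Matrix (Fin n) (Fin n) ℝ} (hM : Mᵀ = M) {m : ℕ}
    (hm : 1 ≤ m) :
    ENNReal.ofReal ((opNorm M / 4) ^ (2 * m)) *
        (ENNReal.ofReal ((1 / 8) ^ n) * volume (Metric.ball (0 : EuclideanSpace ℝ (Fin n)) 1)) ≤
      ∫⁻ x in Metric.ball (0 : EuclideanSpace ℝ (Fin n)) 2,
        ENNReal.ofReal (inner ℝ (Matrix.toEuclideanCLM (n := Fin n) (𝕜 := ℝ) M x) x ^ (2 * m)) := by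
  rcases (opNorm_nonneg M).eq_or_lt with h0 | h0
  · rw [← h0, zero_div, zero_pow (by omega)]
    simp
  obtain ⟨v, hv, hMv⟩ := exists_unit_opNorm_le hM h0
  set T := Matrix.toEuclideanCLM (n := Fin n) (𝕜 := ℝ) M with hT
  have hvol : volume (Metric.ball v (1 / 8)) =
      ENNReal.ofReal ((1 / 8) ^ n) * volume (Metric.ball (0 : EuclideanSpace ℝ (Fin n)) 1) := by
    rw [Measure.addHaar_ball_of_pos _ _ (by norm_num), finrank_euclideanSpace, Fintype.card_fin]
  rw [← hvol, ← setLIntegral_const]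
  -- On the ball of radius `1/8` around the near-maximizer `v` the form is at least a quarter of the
  -- norm in absolute value, and this ball lies in the ball of radius `2` around the origin.
  refine (setLIntegral_mono' measurableSet_ball fun x hx => ?_).trans
    (lintegral_mono_set fun x hx => ?_)
  · rw [mem_ball_iff_norm] at hx
    apply ENNReal.ofReal_le_ofReal
    rw [← (even_two_mul m).pow_abs (inner ℝ (T x) x)]
    apply pow_le_pow_left₀ (by positivity)
    have h1 := abs_inner_sub_le (T := T) hv hx.le
    have h2 : ‖T‖ = opNorm M := rfl
    rw [h2] at h1
    have h3 := abs_sub_abs_le_abs_sub (inner ℝ (T v) v) (inner ℝ (T x) x)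
    rw [abs_sub_comm] at h3
    linarith
  · rw [mem_ball_iff_norm] at hx ⊢
    rw [sub_zero]
    have := norm_add_le (x - v) v
    rw [sub_add_cancel, hv] at this
    linarith

lemma symMat_eq_sum (y : UpperPair n → ℝ) (i j : Fin n) :
    symMat y i j = ∑ e : UpperPair n,
      ((if e.1 = (i, j) then y e else 0) + if e.1 = (j, i) then y e else 0) := by
  rcases lt_trichotomy i j with h | h | h
  · rw [Finset.sum_eq_single ⟨(i, j), h⟩]
    · simp [symMat, h, h.ne]
    · intro e _ he
      rw [if_neg fun h' => he (Subtype.ext h'), if_neg, add_zero]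
      intro h'; have := e.2; rw [h'] at this; exact lt_asymm h this
    · simp
  · subst h
    rw [symMat_self, Finset.sum_eq_zero]
    intro e _
    have : e.1 ≠ (i, i) := fun h' => by have := e.2; rw [h'] at this; exact lt_irrefl _ this
    simp [this]
  · rw [Finset.sum_eq_single ⟨(j, i), h⟩]
    · simp [symMat, h, h.ne, h.not_gt]
    · intro e _ he
      rw [if_neg (c := e.1 = (j, i)) fun h' => he (Subtype.ext h'), if_neg, add_zero]
      intro h'; have := e.2; rw [h'] at this; exact lt_asymm h this
    · simp

lemma matInner_symMat (y : UpperPair n → ℝ) (H : Matrix (Fin n) (Fin n) ℝ) :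
    matInner (symMat y) H = ∑ e : UpperPair n, (H e.1.1 e.1.2 + H e.1.2 e.1.1) * y e := by
  have h1 : ∀ e : UpperPair n, (H e.1.1 e.1.2 + H e.1.2 e.1.1) * y e = ∑ i, ∑ j,
      ((if e.1 = (i, j) then y e else 0) + if e.1 = (j, i) then y e else 0) * H i j := by
    rintro ⟨⟨a, b⟩, h⟩
    simp only [Prod.mk.injEq, ite_and, add_mul, Finset.sum_add_distrib, ite_mul, zero_mul]
    simp
    ring
  simp only [matInner, symMat_eq_sum, h1, Finset.sum_mul]
  symm
  rw [Finset.sum_comm]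
  exact Finset.sum_congr rfl fun i _ => Finset.sum_comm

lemma inner_symMat (y : UpperPair n → ℝ) (x : EuclideanSpace ℝ (Fin n)) :
    inner ℝ (Matrix.toEuclideanCLM (n := Fin n) (𝕜 := ℝ) (symMat y) x) x =
      ∑ e : UpperPair n, 2 * (x e.1.1 * x e.1.2) * y e := by
  have h1 : inner ℝ (Matrix.toEuclideanCLM (n := Fin n) (𝕜 := ℝ) (symMat y) x) x =
      matInner (symMat y) (vecMulVec x.ofLp x.ofLp) := by
    rw [real_inner_comm, Matrix.inner_toEuclideanCLM]
    simp only [matInner, vecMulVec_apply, mulVec, dotProduct, Finset.mul_sum]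
    exact Finset.sum_congr rfl fun i _ => Finset.sum_congr rfl fun j _ => by ring
  rw [h1, matInner_symMat]
  exact Finset.sum_congr rfl fun e _ => by rw [vecMulVec_apply, vecMulVec_apply]; ring

lemma sum_upperPair_le (f : Fin n → Fin n → ℝ) (hf : ∀ i j, 0 ≤ f i j) :
    ∑ e : UpperPair n, f e.1.1 e.1.2 ≤ ∑ i, ∑ j, f i j := by
  rw [← Finset.sum_product', Finset.univ_product_univ,
    ← Finset.sum_subtype (Finset.univ.filter fun p : Fin n × Fin n => p.1 < p.2) (by simp)
      fun p : Fin n × Fin n => f p.1 p.2]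
  exact Finset.sum_le_sum_of_subset_of_nonneg (Finset.filter_subset _ _) fun p _ _ => hf _ _

/-- Even moments of sub-Gaussian variables. -/
lemma lintegral_pow_le_of_hasSubgaussianMGF {Ω : Type*} [MeasurableSpace Ω] {μ : Measure Ω}
    {Z : Ω → ℝ} {c : NNReal} (hZ : HasSubgaussianMGF Z c μ) (hc : (c : ℝ) ≤ 144) {m : ℕ}
    (hm : 1 ≤ m) :
    ∫⁻ ω, ENNReal.ofReal (Z ω ^ (2 * m)) ∂μ ≤ ENNReal.ofReal (2 * (1152 * m) ^ m) := by
  -- This `s` makes `c * s ^ 2 / 2 ≤ m / 2` for `c ≤ 144`, so both exponential moments are at most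
  -- `2 ^ m`.
  set s := Real.sqrt m / 12 with hs
  have hm0 : (0 : ℝ) < m := by exact_mod_cast hm
  have hs0 : 0 < s := by positivity
  have hs2 : s ^ 2 = m / 144 := by rw [hs, div_pow, Real.sq_sqrt hm0.le]; norm_num
  have hpt : ∀ ω, Z ω ^ (2 * m) ≤ ((2 * m).factorial / s ^ (2 * m)) *
      (Real.exp (s * Z ω) + Real.exp (-s * Z ω)) := fun ω => by
    have h1 := Real.pow_div_factorial_le_exp _ (abs_nonneg (s * Z ω)) (2 * m)
    have h2 : Real.exp |s * Z ω| ≤ Real.exp (s * Z ω) + Real.exp (-s * Z ω) := by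
      rw [neg_mul]; exact Real.exp_abs_le _
    rw [(even_two_mul m).pow_abs, mul_pow] at h1
    have h3 := h1.trans h2
    rw [div_le_iff₀ (by positivity)] at h3
    rw [div_mul_eq_mul_div, le_div_iff₀ (by positivity)]
    linarith
  have hint : Integrable (fun ω => Real.exp (s * Z ω) + Real.exp (-s * Z ω)) μ := (hZ.integrable_exp_mul s).add (hZ.integrable_exp_mul (-s))
  calc ∫⁻ ω, ENNReal.ofReal (Z ω ^ (2 * m)) ∂μ
      ≤ ∫⁻ ω, ENNReal.ofReal (((2 * m).factorial / s ^ (2 * m)) *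
          (Real.exp (s * Z ω) + Real.exp (-s * Z ω))) ∂μ :=
        lintegral_mono fun ω => ENNReal.ofReal_le_ofReal (hpt ω)
    _ = ENNReal.ofReal (∫ ω, ((2 * m).factorial / s ^ (2 * m)) *
          (Real.exp (s * Z ω) + Real.exp (-s * Z ω)) ∂μ) := by
        rw [ofReal_integral_eq_lintegral_ofReal (hint.const_mul _)]
        exact ae_of_all _ fun ω => by positivity
    _ ≤ _ := by
        apply ENNReal.ofReal_le_ofReal
        rw [integral_const_mul, integral_add (hZ.integrable_exp_mul s) (hZ.integrable_exp_mul (-s))]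
        have h1 := hZ.mgf_le s
        have h2 := hZ.mgf_le (-s)
        rw [neg_sq] at h2
        rw [mgf] at h1 h2
        have h3 : Real.exp (c * s ^ 2 / 2) ≤ 2 ^ m := by
          have h4 : c * s ^ 2 / 2 ≤ m * (1 / 2 : ℝ) := by rw [hs2]; nlinarith
          have h5 : Real.exp (1 / 2) ≤ 2 := by
            have h6 := Real.exp_one_lt_d9
            have h7 : Real.exp (1 / 2) * Real.exp (1 / 2) = Real.exp 1 := by
              rw [← Real.exp_add]; norm_num
            nlinarith [Real.exp_pos (1 / 2)]
          calc _ ≤ Real.exp (m * (1 / 2)) := Real.exp_le_exp.mpr h4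
            _ = Real.exp (1 / 2) ^ m := Real.exp_nat_mul _ _
            _ ≤ _ := pow_le_pow_left₀ (Real.exp_pos _).le h5 m
        have h8 : ((2 * m).factorial : ℝ) ≤ (2 * m) ^ (2 * m) := by
          exact_mod_cast Nat.factorial_le_pow (2 * m)
        calc _ ≤ ((2 * m) ^ (2 * m) / s ^ (2 * m)) * (2 ^ m + 2 ^ m : ℝ) := by
              gcongr <;> linarith
          _ = _ := by
              rw [pow_mul s, hs2, pow_mul (2 * (m : ℝ)), ← div_pow, ← two_mul, mul_left_comm,
                ← mul_pow]
              congr 2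
              field_simp
              ring

end NormMoments

end LatentSpace

/-! ### The dense comparison model and the resulting tail bound for sparse matrices. -/

namespace LatentSpace

open Matrix

section SubGaussian

variable {Ω : Type*} [MeasurableSpace Ω] {μ : Measure Ω}

lemma hasSubgaussianMGF_mono {Z : Ω → ℝ} {c c' : NNReal} (h : HasSubgaussianMGF Z c μ)
    (hc : c ≤ c') : HasSubgaussianMGF Z c' μ where
  integrable_exp_mul := h.integrable_exp_mul
  mgf_le t := (h.mgf_le t).trans (Real.exp_le_exp.mpr (by
    have : (c : ℝ) ≤ c' := hc
    gcongr))

/-- Weighted sums of independent sub-Gaussian variables. -/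
lemma hasSubgaussianMGF_weighted_sum {ι : Type*} [Fintype ι] {ξ : ι → Ω → ℝ} (hi : iIndepFun ξ μ)
    {c : NNReal} (hξ : ∀ e, HasSubgaussianMGF (ξ e) c μ) (w : ι → ℝ) {c' : NNReal}
    (hc : (∑ e, w e ^ 2) * c ≤ c') :
    HasSubgaussianMGF (fun ω => ∑ e, w e * ξ e ω) c' μ := by
  have h1 := hi.comp (fun e x => w e * x) fun e => measurable_const_mul _
  have h2 := HasSubgaussianMGF.sum_of_iIndepFun (s := Finset.univ) h1
    fun e _ => (hξ e).const_mul (w e)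
  refine hasSubgaussianMGF_mono h2 ?_
  rw [← NNReal.coe_le_coe, NNReal.coe_sum]
  refine le_trans (le_of_eq ?_) hc
  rw [Finset.sum_mul]
  rfl

end SubGaussian

section DenseModel

/-- A two-point variable with mean zero all of whose higher moments are at least one. -/
noncomputable def denseEntry (b : Bool) : ℝ := if b then 2 else -1

/-- The law under which `denseEntry` is centered. -/
noncomputable def denseLaw : Measure Bool :=
  ENNReal.ofReal (1 / 3) • Measure.dirac true + ENNReal.ofReal (2 / 3) • Measure.dirac false

instance : IsProbabilityMeasure denseLaw where
  measure_univ := by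
    simp only [denseLaw, Measure.coe_add, Measure.coe_smul, Pi.add_apply, Pi.smul_apply,
      measure_univ, smul_eq_mul, mul_one]
    rw [← ENNReal.ofReal_add (by norm_num) (by norm_num)]
    norm_num

lemma integral_denseLaw (f : Bool → ℝ) :
    ∫ b, f b ∂denseLaw = 1 / 3 * f true + 2 / 3 * f false := by
  have h1 : IsFiniteMeasure (ENNReal.ofReal (1 / 3) • Measure.dirac true) :=
    Measure.smul_finite _ ENNReal.ofReal_ne_top
  have h2 : IsFiniteMeasure (ENNReal.ofReal (2 / 3) • Measure.dirac false) :=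
    Measure.smul_finite _ ENNReal.ofReal_ne_top
  rw [denseLaw, integral_add_measure Integrable.of_finite Integrable.of_finite,
    integral_smul_measure, integral_smul_measure, integral_dirac, integral_dirac,
    ENNReal.toReal_ofReal (by norm_num), ENNReal.toReal_ofReal (by norm_num), smul_eq_mul,
    smul_eq_mul]

/-- The law is skewed on purpose: for a symmetric law odd moments vanish, and walks using an edge an
odd number of times would be lost. -/
lemma one_le_integral_denseEntry_pow {k : ℕ} (hk : 2 ≤ k) :
    1 ≤ ∫ b, denseEntry b ^ k ∂denseLaw := by
  rw [integral_denseLaw]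
  simp only [denseEntry, if_true, Bool.false_eq_true, if_false]
  rcases hk.eq_or_lt with rfl | hk
  · norm_num
  · have h1 : (2 : ℝ) ^ 3 ≤ 2 ^ k := pow_le_pow_right₀ (by norm_num) hk
    rcases neg_one_pow_eq_or ℝ k with h | h <;> rw [h] <;> linarith

variable (n : ℕ)

/-- The law of the dense random symmetric matrix model. -/
noncomputable abbrev denseMeasure : Measure (UpperPair n → Bool) := Measure.pi fun _ => denseLaw

variable {n}

lemma iIndepFun_dense : iIndepFun (fun (e : UpperPair n) (ω : UpperPair n → Bool) =>
    denseEntry (ω e)) (denseMeasure n) :=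
  iIndepFun_pi (X := fun _ => denseEntry) fun _ => (measurable_of_finite _).aemeasurable

lemma integral_dense (e : UpperPair n) (f : Bool → ℝ) :
    ∫ ω : UpperPair n → Bool, f (ω e) ∂denseMeasure n = ∫ b, f b ∂denseLaw := by
  have h := measurePreserving_eval (fun _ : UpperPair n => denseLaw) e
  rw [← h.map_eq, integral_map h.aemeasurable (measurable_of_finite _).aestronglyMeasurable]

lemma abs_denseEntry_le (b : Bool) : |denseEntry b| ≤ 2 := by
  cases b <;> simp [denseEntry]

lemma integral_denseEntry_eq_zero (e : UpperPair n) :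
    ∫ ω : UpperPair n → Bool, denseEntry (ω e) ∂denseMeasure n = 0 := by
  rw [integral_dense, integral_denseLaw]
  simp only [denseEntry, if_true, Bool.false_eq_true, if_false]
  norm_num

lemma measurable_denseEntry (e : UpperPair n) :
    Measurable fun ω : UpperPair n → Bool => denseEntry (ω e) :=
  (measurable_of_finite denseEntry).comp (measurable_pi_apply e)

lemma hasSubgaussianMGF_dense (e : UpperPair n) :
    HasSubgaussianMGF (fun ω : UpperPair n → Bool => denseEntry (ω e)) (9 / 4) (denseMeasure n) := by
  have h := hasSubgaussianMGF_of_mem_Icc_of_integral_eq_zero (μ := denseMeasure n)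
    (X := fun ω : UpperPair n → Bool => denseEntry (ω e)) (a := -1) (b := 2)
    (measurable_denseEntry e).aemeasurable
    (ae_of_all _ fun ω => by
      cases ω e <;> simp only [denseEntry, if_true, Bool.false_eq_true, if_false] <;> norm_num)
    (integral_denseEntry_eq_zero e)
  refine hasSubgaussianMGF_mono h (le_of_eq ?_)
  rw [← NNReal.coe_inj]
  push_cast
  norm_num

/-- Moments of the quadratic form of the dense model. -/
lemma lintegral_inner_dense_pow_le {x : EuclideanSpace ℝ (Fin n)} (hx : ‖x‖ ≤ 2) {m : ℕ}
    (hm : 1 ≤ m) :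
    ∫⁻ ω : UpperPair n → Bool, ENNReal.ofReal (inner ℝ (Matrix.toEuclideanCLM (n := Fin n) (𝕜 := ℝ)
      (symMat fun e => denseEntry (ω e)) x) x ^ (2 * m)) ∂denseMeasure n ≤
      ENNReal.ofReal (2 * (1152 * m) ^ m) := by
  simp only [inner_symMat]
  -- The squared weights sum to at most `4 * 2⁴ = 64`, and `64 * 9/4 = 144`.
  refine lintegral_pow_le_of_hasSubgaussianMGF (c := 144)
    (hasSubgaussianMGF_weighted_sum iIndepFun_dense hasSubgaussianMGF_dense _ ?_) (by norm_num) hm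
  have h1 : ∑ e : UpperPair n, (2 * (x e.1.1 * x e.1.2)) ^ 2 ≤ 4 * (‖x‖ ^ 2 * ‖x‖ ^ 2) := by
    have := sum_upperPair_le (n := n) (fun i j => 4 * (x i ^ 2 * x j ^ 2)) fun i j => by positivity
    rw [EuclideanSpace.real_norm_sq_eq, Finset.sum_mul_sum, Finset.mul_sum]
    simp only [Finset.mul_sum]
    refine le_trans (le_of_eq (Finset.sum_congr rfl fun e _ => ?_)) this
    ring
  have h2 : ‖x‖ ^ 2 ≤ 4 := by nlinarith [norm_nonneg x]
  push_cast
  nlinarith [sq_nonneg ‖x‖]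

lemma continuous_inner_toEuclideanCLM (M : Matrix (Fin n) (Fin n) ℝ) :
    Continuous fun x : EuclideanSpace ℝ (Fin n) =>
      (inner ℝ (Matrix.toEuclideanCLM (n := Fin n) (𝕜 := ℝ) M x) x : ℝ) := by
  fun_prop

lemma lintegral_setLIntegral_le {α β : Type*} [MeasurableSpace α] [MeasurableSpace β]
    {μ : Measure α} [SFinite μ] {ν : Measure β} [SFinite ν] {F : α → β → ENNReal}
    (hF : Measurable (Function.uncurry F)) {S : Set β} (hS : MeasurableSet S) {c : ENNReal}
    (hc : ∀ b ∈ S, ∫⁻ a, F a b ∂μ ≤ c) :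
    ∫⁻ a, ∫⁻ b in S, F a b ∂ν ∂μ ≤ c * ν S := by
  rw [lintegral_lintegral_swap hF.aemeasurable, ← setLIntegral_const]
  exact setLIntegral_mono' hS hc

/-- Even powers of the quadratic form of the dense model. -/
noncomputable def denseForm (m : ℕ) (ω : UpperPair n → Bool) (x : EuclideanSpace ℝ (Fin n)) :
    ENNReal :=
  ENNReal.ofReal (inner ℝ (Matrix.toEuclideanCLM (n := Fin n) (𝕜 := ℝ)
    (symMat fun e => denseEntry (ω e)) x) x ^ (2 * m))

/-- The sample space is countable, so continuity in `x` suffices. -/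
lemma measurable_denseForm {m : ℕ} : Measurable (Function.uncurry (denseForm (n := n) m)) :=
  measurable_from_prod_countable_right fun ω =>
    ((continuous_inner_toEuclideanCLM (symMat fun e => denseEntry (ω e))).measurable.pow_const
      (2 * m)).ennreal_ofReal

/-- Tonelli: average over the ball of radius `2`, then apply the moment bound at each fixed `x`. The
volume of the unit ball cancels, leaving factors exponential in `n`, which are harmless once `n` is
comparable to `m`. -/
lemma integral_opNorm_dense_pow_mul_le [NeZero n] {m : ℕ} (hm : 1 ≤ m) :
    (∫ ω : UpperPair n → Bool, (opNorm (symMat fun e => denseEntry (ω e)) / 4) ^ (2 * m)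
      ∂denseMeasure n) * (1 / 8) ^ n ≤ 2 * (1152 * m) ^ m * 2 ^ n := by
  set V := volume (Metric.ball (0 : EuclideanSpace ℝ (Fin n)) 1) with hV
  have hV0 : V ≠ 0 := (Metric.measure_ball_pos _ _ one_pos).ne'
  have hVt : V ≠ ⊤ := measure_ball_lt_top.ne
  have hV2 : volume (Metric.ball (0 : EuclideanSpace ℝ (Fin n)) 2) =
      ENNReal.ofReal (2 ^ n) * V := by
    rw [Measure.addHaar_ball_of_pos _ _ (by norm_num), finrank_euclideanSpace, Fintype.card_fin]
  have hnn : ∀ ω : UpperPair n → Bool,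
      0 ≤ (opNorm (symMat fun e => denseEntry (ω e)) / 4) ^ (2 * m) :=
    fun ω => pow_nonneg (div_nonneg (opNorm_nonneg _) (by norm_num)) _
  have h1 : ∫⁻ ω, (∫⁻ x in Metric.ball (0 : EuclideanSpace ℝ (Fin n)) 2, denseForm m ω x)
      ∂denseMeasure n ≤ ENNReal.ofReal (2 * (1152 * m) ^ m) *
      volume (Metric.ball (0 : EuclideanSpace ℝ (Fin n)) 2) :=
    lintegral_setLIntegral_le measurable_denseForm measurableSet_ball fun x hx =>
      lintegral_inner_dense_pow_le (by rw [mem_ball_zero_iff] at hx; exact hx.le) hm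
  have h2 : ∫⁻ ω : UpperPair n → Bool, ENNReal.ofReal
      ((opNorm (symMat fun e => denseEntry (ω e)) / 4) ^ (2 * m)) *
        (ENNReal.ofReal ((1 / 8) ^ n) * V) ∂denseMeasure n ≤
      ∫⁻ ω, (∫⁻ x in Metric.ball (0 : EuclideanSpace ℝ (Fin n)) 2, denseForm m ω x)
        ∂denseMeasure n :=
    lintegral_mono fun ω : UpperPair n → Bool =>
      opNorm_pow_mul_volume_le (symMat_transpose fun e => denseEntry (ω e)) hm
  have h3 := h2.trans h1
  rw [lintegral_mul_const _ (measurable_of_finite _), hV2,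
    ← ofReal_integral_eq_lintegral_ofReal Integrable.of_finite (ae_of_all _ hnn), ← mul_assoc,
    ← mul_assoc, ← ENNReal.ofReal_mul (integral_nonneg hnn), ← ENNReal.ofReal_mul (by positivity),
    ENNReal.mul_le_mul_iff_left hV0 hVt, ENNReal.ofReal_le_ofReal_iff (by positivity)] at h3
  exact h3

/-- Moments of the operator norm of the dense model in dimension `2 m`. -/
lemma integral_opNorm_dense_pow_le {m : ℕ} (hm : 1 ≤ m) :
    ∫ ω : UpperPair (2 * m) → Bool, opNorm (symMat fun e => denseEntry (ω e)) ^ (2 * m)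
      ∂denseMeasure (2 * m) ≤ (10 ^ 7 * m) ^ m := by
  have : NeZero (2 * m) := ⟨by omega⟩
  have h1 := integral_opNorm_dense_pow_mul_le (n := 2 * m) hm
  simp only [div_pow, integral_div, one_pow] at h1
  rw [mul_one_div, div_div, div_le_iff₀ (by positivity)] at h1
  refine h1.trans ?_
  have h4 : (2 : ℝ) ≤ 2 ^ m := by
    calc (2 : ℝ) = 2 ^ 1 := (pow_one 2).symm
      _ ≤ _ := pow_le_pow_right₀ (by norm_num) hm
  -- The factor `2` is absorbed as `2 ^ m`; the base is then `9437184 * m`, below `10 ^ 7 * m`.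
  calc 2 * (1152 * m) ^ m * 2 ^ (2 * m) * (4 ^ (2 * m) * 8 ^ (2 * m))
      ≤ (2 : ℝ) ^ m * (1152 * m) ^ m * 2 ^ (2 * m) * (4 ^ (2 * m) * 8 ^ (2 * m)) := by gcongr
    _ = (2 * (1152 * m) * 2 ^ 2 * (4 ^ 2 * 8 ^ 2) : ℝ) ^ m := by
        simp only [pow_mul, ← mul_pow]
    _ ≤ _ := by
        apply pow_le_pow_left₀ (by positivity)
        have : (0 : ℝ) ≤ m := by positivity
        linarith

open Classical in
-- A combinatorial count obtained analytically: the dense trace moment dominates the count and is at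
-- most the dimension times the moment of the norm.
lemma card_isDoubled_le {m : ℕ} (hm : 1 ≤ m) :
    ((Finset.univ.filter fun w : Fin (2 * m + 1) → Fin (2 * m) => IsDoubled w).card : ℝ) ≤
      (2 * m : ℕ) * (10 ^ 7 * m) ^ m := by
  refine (card_isDoubled_le_integral_trace (μ := denseMeasure (2 * m)) measurable_denseEntry
    iIndepFun_dense zero_le_two (fun e ω => abs_denseEntry_le _) integral_denseEntry_eq_zero
    (fun e k hk => ?_) (2 * m)).trans ?_
  · rw [integral_dense e fun b => denseEntry b ^ k]
    exact one_le_integral_denseEntry_pow hk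
  · refine (integral_mono Integrable.of_finite Integrable.of_finite
      fun ω => trace_pow_le _ (by omega)).trans ?_
    rw [integral_const_mul]
    exact mul_le_mul_of_nonneg_left (integral_opNorm_dense_pow_le hm) (by positivity)

end DenseModel

section SparseModel

variable {n : ℕ} {Ω : Type*} [MeasurableSpace Ω] {μ : Measure Ω} [IsProbabilityMeasure μ]
  {ξ : UpperPair n → Ω → ℝ}

/-- Trace moments of a sparse centered random symmetric matrix. -/
lemma integral_trace_pow_le_of_sparse (hm : ∀ e, Measurable (ξ e)) (hi : iIndepFun ξ μ) {p : ℝ}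
    (hp : 0 ≤ p) (hp1 : p ≤ 1) (hb : ∀ e ω, |ξ e ω| ≤ 1) (h0 : ∀ e, ∫ ω, ξ e ω ∂μ = 0)
    (hpow : ∀ e k, 2 ≤ k → |∫ ω, ξ e ω ^ k ∂μ| ≤ p) {m : ℕ} (hm1 : 1 ≤ m) (hnp : n * p ≤ m) :
    ∫ ω, ((symMat fun e => ξ e ω) ^ (2 * m)).trace ∂μ ≤ n * (10 ^ 7 * m) ^ m := by
  classical
  have h1 := integral_trace_symMat_pow_le hm hi hp hp1 hb h0 hpow (2 * m)
  have h2 := sum_doubled_pow_card_le n m hm1 hp hp1 hnp le_rfl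
  have h3 := mul_le_mul_of_nonneg_left (card_isDoubled_le hm1) (Nat.cast_nonneg (α := ℝ) n)
  have h4 : (0 : ℝ) < (2 * m : ℕ) := by exact_mod_cast (by omega : 0 < 2 * m)
  refine h1.trans (le_of_mul_le_mul_right ((h2.trans h3).trans (le_of_eq ?_)) h4)
  ring

/-- Tail bound for the operator norm of a sparse centered random symmetric matrix. -/
lemma measure_opNorm_ge_le (hm : ∀ e, Measurable (ξ e)) (hi : iIndepFun ξ μ) {p : ℝ}
    (hp : 0 ≤ p) (hp1 : p ≤ 1) (hb : ∀ e ω, |ξ e ω| ≤ 1) (h0 : ∀ e, ∫ ω, ξ e ω ∂μ = 0)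
    (hpow : ∀ e k, 2 ≤ k → |∫ ω, ξ e ω ^ k ∂μ| ≤ p) {s : ℕ} (hnp : n * p ≤ (2 ^ s : ℕ)) {t : ℝ}
    (ht : 0 < t) :
    μ.real {ω | t ≤ opNorm (symMat fun e => ξ e ω)} ≤
      n * (10 ^ 7 * (2 ^ s : ℕ) / t ^ 2) ^ (2 ^ s) := by
  have h1 := integral_trace_pow_le_of_sparse hm hi hp hp1 hb h0 hpow Nat.one_le_two_pow hnp
  have hle : ∀ ω, opNorm (symMat fun e => ξ e ω) ^ (2 * 2 ^ s) ≤
      ((symMat fun e => ξ e ω) ^ (2 * 2 ^ s)).trace :=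
    fun ω => opNorm_pow_le_trace (symMat_transpose _) s
  -- Markov's inequality for the trace, which dominates the power of the norm pointwise.
  have h2 := mul_meas_ge_le_integral_of_nonneg (μ := μ)
    (ae_of_all _ fun ω => (pow_nonneg (opNorm_nonneg _) _).trans (hle ω))
    (integrable_trace_symMat_pow hm zero_le_one hb (2 * 2 ^ s)) (t ^ (2 * 2 ^ s))
  have h3 : μ.real {ω | t ≤ opNorm (symMat fun e => ξ e ω)} ≤
      μ.real {ω | t ^ (2 * 2 ^ s) ≤ ((symMat fun e => ξ e ω) ^ (2 * 2 ^ s)).trace} :=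
    measureReal_mono fun ω hω => (pow_le_pow_left₀ ht.le hω _).trans (hle ω)
  rw [div_pow, ← pow_mul, ← mul_div_assoc, le_div_iff₀ (by positivity)]
  calc _ ≤ μ.real {ω | t ^ (2 * 2 ^ s) ≤ ((symMat fun e => ξ e ω) ^ (2 * 2 ^ s)).trace} *
        t ^ (2 * 2 ^ s) := by gcongr
    _ = _ := mul_comm _ _
    _ ≤ _ := h2.trans h1

end SparseModel

end LatentSpace

/-! ### The noise of a Bernoulli network. -/

namespace LatentSpace

open Matrix

section BernoulliNetwork

variable {n : ℕ} {Ω : Type*} [MeasurableSpace Ω] {μ : Measure Ω} [IsProbabilityMeasure μ]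
  {P : Matrix (Fin n) (Fin n) ℝ} {A : Ω → Matrix (Fin n) (Fin n) ℝ}

/-- The centered entries of a random adjacency matrix above the diagonal. -/
def centeredEntry (P : Matrix (Fin n) (Fin n) ℝ) (A : Ω → Matrix (Fin n) (Fin n) ℝ)
    (e : UpperPair n) (ω : Ω) : ℝ := A ω e.1.1 e.1.2 - P e.1.1 e.1.2

omit [IsProbabilityMeasure μ] in
lemma IsBernoulliNetwork.measurable_centeredEntry (h : IsBernoulliNetwork μ P A)
    (e : UpperPair n) : Measurable (centeredEntry P A e) :=
  (h.measurable_entry _ _).sub_const _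

omit [IsProbabilityMeasure μ] in
lemma IsBernoulliNetwork.iIndepFun_centeredEntry (h : IsBernoulliNetwork μ P A) :
    iIndepFun (centeredEntry P A) μ :=
  h.indep.comp (fun e x => x - P e.1.1 e.1.2) fun _ => measurable_id.sub_const _

omit [IsProbabilityMeasure μ] in
lemma IsBernoulliNetwork.integral_entry (h : IsBernoulliNetwork μ P A) (hP : ∀ i j, 0 ≤ P i j)
    (e : UpperPair n) : ∫ ω, A ω e.1.1 e.1.2 ∂μ = P e.1.1 e.1.2 := by
  have h1 : (fun ω => A ω e.1.1 e.1.2) = Set.indicator {ω | A ω e.1.1 e.1.2 = 1} 1 := by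
    ext ω
    rcases (h.adjacency ω).2.2 e.1.1 e.1.2 with h0 | h0 <;>
      simp [h0]
  have hms : MeasurableSet {ω | A ω e.1.1 e.1.2 = 1} :=
    h.measurable_entry _ _ (measurableSet_singleton 1)
  rw [h1, integral_indicator_one hms, measureReal_def, h.prob_one _ _ e.2,
    ENNReal.toReal_ofReal (hP _ _)]

lemma IsBernoulliNetwork.integrable_entry (h : IsBernoulliNetwork μ P A) (i j : Fin n) :
    Integrable (fun ω => A ω i j) μ :=
  Integrable.of_bound (C := 1) (h.measurable_entry _ _).aestronglyMeasurable
    (ae_of_all _ fun ω => by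
      rcases (h.adjacency ω).2.2 i j with h0 | h0 <;> simp [h0])

lemma IsBernoulliNetwork.integral_centeredEntry (h : IsBernoulliNetwork μ P A)
    (hP : ∀ i j, 0 ≤ P i j) (e : UpperPair n) : ∫ ω, centeredEntry P A e ω ∂μ = 0 := by
  simp only [centeredEntry]
  rw [integral_sub (h.integrable_entry _ _) (integrable_const _), h.integral_entry hP]
  simp

omit [IsProbabilityMeasure μ] in
lemma IsBernoulliNetwork.centeredEntry_mem (h : IsBernoulliNetwork μ P A) (e : UpperPair n)
    (ω : Ω) : centeredEntry P A e ω ∈ Set.Icc (-P e.1.1 e.1.2) (1 - P e.1.1 e.1.2) := by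
  rcases (h.adjacency ω).2.2 e.1.1 e.1.2 with h0 | h0 <;> simp [centeredEntry, h0]

omit [IsProbabilityMeasure μ] in
lemma IsBernoulliNetwork.abs_centeredEntry_le (h : IsBernoulliNetwork μ P A)
    (hP : ∀ i j, 0 ≤ P i j) (hP1 : ∀ i j, P i j ≤ 1) (e : UpperPair n) (ω : Ω) :
    |centeredEntry P A e ω| ≤ 1 := by
  have h1 := h.centeredEntry_mem e ω
  have h2 := hP e.1.1 e.1.2
  have h3 := hP1 e.1.1 e.1.2
  exact abs_le.mpr ⟨by linarith [h1.1], by linarith [h1.2]⟩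

/-- Entries are bounded by one, so the second moment dominates and equals `q - q ^ 2`. On `{0, 1}`
the square `(a - q) ^ 2` is the affine function `(1 - 2 * q) * a + q ^ 2`. -/
lemma IsBernoulliNetwork.abs_integral_centeredEntry_pow_le (h : IsBernoulliNetwork μ P A)
    (hP : ∀ i j, 0 ≤ P i j) (hP1 : ∀ i j, P i j ≤ 1) (e : UpperPair n) {k : ℕ} (hk : 2 ≤ k) :
    |∫ ω, centeredEntry P A e ω ^ k ∂μ| ≤ P e.1.1 e.1.2 := by
  set q := P e.1.1 e.1.2 with hq
  have hq0 : 0 ≤ q := hP _ _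
  have hint : Integrable (fun ω => (1 - 2 * q) * A ω e.1.1 e.1.2 + q ^ 2) μ :=
    ((h.integrable_entry _ _).const_mul _).add (integrable_const _)
  have h1 : ∫ ω, ((1 - 2 * q) * A ω e.1.1 e.1.2 + q ^ 2) ∂μ = q - q ^ 2 := by
    rw [integral_add ((h.integrable_entry _ _).const_mul _) (integrable_const _),
      integral_const_mul, h.integral_entry hP]
    simp
    ring
  refine (abs_integral_le_integral_abs).trans ?_
  calc ∫ ω, |centeredEntry P A e ω ^ k| ∂μ
      ≤ ∫ ω, ((1 - 2 * q) * A ω e.1.1 e.1.2 + q ^ 2) ∂μ := by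
        refine integral_mono_of_nonneg (ae_of_all _ fun ω => abs_nonneg _) hint
          (ae_of_all _ fun ω => ?_)
        have h2 : |centeredEntry P A e ω ^ k| ≤ centeredEntry P A e ω ^ 2 := by
          rw [abs_pow, ← sq_abs (centeredEntry P A e ω)]
          exact pow_le_pow_of_le_one (abs_nonneg _) (h.abs_centeredEntry_le hP hP1 e ω) hk
        refine h2.trans (le_of_eq ?_)
        rcases (h.adjacency ω).2.2 e.1.1 e.1.2 with h0 | h0 <;>
          simp only [centeredEntry, h0, ← hq] <;> ring
    _ ≤ q := by rw [h1]; nlinarith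

lemma IsBernoulliNetwork.hasSubgaussianMGF_centeredEntry (h : IsBernoulliNetwork μ P A)
    (hP : ∀ i j, 0 ≤ P i j) (e : UpperPair n) :
    HasSubgaussianMGF (centeredEntry P A e) (1 / 4) μ := by
  refine hasSubgaussianMGF_mono (hasSubgaussianMGF_of_mem_Icc_of_integral_eq_zero
    (h.measurable_centeredEntry e).aemeasurable (ae_of_all _ (h.centeredEntry_mem e))
    (h.integral_centeredEntry hP e)) (le_of_eq ?_)
  rw [← NNReal.coe_inj]
  push_cast
  rw [sub_neg_eq_add, sub_add_cancel]
  norm_num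

/-- Hoeffding's bound for linear functionals of the noise. -/
lemma IsBernoulliNetwork.measure_abs_matInner_ge_le (h : IsBernoulliNetwork μ P A)
    (hP : ∀ i j, 0 ≤ P i j) {H : Matrix (Fin n) (Fin n) ℝ} (hH : H.IsSymm)
    (hH1 : froNorm H ≤ 1) {t : ℝ} (ht : 0 ≤ t) :
    μ.real {ω | t ≤ |matInner (symMat fun e => centeredEntry P A e ω) H|} ≤
      2 * Real.exp (-t ^ 2 / 2) := by
  have hsub : HasSubgaussianMGF
      (fun ω => matInner (symMat fun e => centeredEntry P A e ω) H) 1 μ := by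
    simp only [matInner_symMat]
    -- Symmetry doubles each weight, giving a factor `4` that cancels the variance proxy `1/4`.
    refine hasSubgaussianMGF_weighted_sum h.iIndepFun_centeredEntry
      (h.hasSubgaussianMGF_centeredEntry hP) _ ?_
    have h1 := sum_upperPair_le (fun i j => H i j ^ 2) fun i j => sq_nonneg _
    rw [← froNorm_sq] at h1
    have h2 : ∑ e : UpperPair n, (H e.1.1 e.1.2 + H e.1.2 e.1.1) ^ 2 =
        4 * ∑ e : UpperPair n, H e.1.1 e.1.2 ^ 2 := by
      rw [Finset.mul_sum]
      refine Finset.sum_congr rfl fun e _ => ?_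
      rw [hH.apply]
      ring
    rw [h2]
    push_cast
    nlinarith [froNorm_nonneg H]
  have h1 := hsub.measure_ge_le ht
  have h2 := hsub.neg.measure_ge_le ht
  have hsubset : {ω | t ≤ |matInner (symMat fun e => centeredEntry P A e ω) H|} ⊆
      {ω | t ≤ matInner (symMat fun e => centeredEntry P A e ω) H} ∪
      {ω | t ≤ (-fun ω => matInner (symMat fun e => centeredEntry P A e ω) H) ω} :=
    fun ω hω => by
      rcases le_abs.mp (show t ≤ |_| from hω) with h0 | h0
      · exact Or.inl h0
      · exact Or.inr h0
  have h3 := (measureReal_mono (μ := μ) hsubset).trans (measureReal_union_le _ _)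
  simp only [NNReal.coe_one, mul_one] at h1 h2
  linarith

/-- Take the least admissible exponent: half of its power is below `d`, and the lower bound on `d`
covers exponent zero. -/
lemma exists_two_pow_between {d : ℝ} (hd : 1 / 4 ≤ d) :
    ∃ s : ℕ, d ≤ (2 ^ s : ℕ) ∧ ((2 ^ s : ℕ) : ℝ) ≤ 4 * d := by
  have hex : ∃ s : ℕ, d ≤ (2 ^ s : ℕ) := by
    obtain ⟨s, hs⟩ := pow_unbounded_of_one_lt d (one_lt_two)
    exact ⟨s, by push_cast; exact hs.le⟩
  classical
  refine ⟨Nat.find hex, Nat.find_spec hex, ?_⟩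
  rcases Nat.eq_zero_or_pos (Nat.find hex) with h | h
  · rw [h]; norm_num; linarith
  · have h1 := Nat.find_min hex (m := Nat.find hex - 1) (by omega)
    obtain ⟨r, hr⟩ : ∃ r, Nat.find hex = r + 1 := ⟨Nat.find hex - 1, by omega⟩
    rw [hr, Nat.add_sub_cancel] at h1
    rw [hr]
    push_cast at h1 ⊢
    rw [pow_succ]
    linarith

/-- Concentration of the centered adjacency matrix in operator norm, without a logarithmic
factor. -/
lemma IsBernoulliNetwork.measure_opNorm_ge_le (h : IsBernoulliNetwork μ P A)
    (hP : ∀ i j, 0 ≤ P i j) {p : ℝ} (hp1 : p ≤ 1) (hPp : ∀ i j, i ≠ j → P i j ≤ p)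
    (hP1 : ∀ i j, P i j ≤ 1) (hp : 0 ≤ p) (hn : 2 ≤ n) {d : ℝ} (hd : n * p ≤ d)
    (hd' : Real.log n ≤ d) :
    μ.real {ω | 10 ^ 5 * Real.sqrt d ≤ opNorm (symMat fun e => centeredEntry P A e ω)} ≤
      n * Real.exp (-5 * Real.log n) := by
  have hn2 : (2 : ℝ) ≤ n := by exact_mod_cast hn
  have hlog : Real.log 2 ≤ Real.log n := Real.log_le_log (by norm_num) hn2
  have hl2 := Real.log_two_gt_d9
  have hd0 : 0 < d := by linarith
  obtain ⟨s, hs1, hs2⟩ := exists_two_pow_between (d := d) (by linarith)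
  have hsd : (10 ^ 5 * Real.sqrt d) ^ 2 = 10 ^ 10 * d := by
    rw [mul_pow, Real.sq_sqrt hd0.le]; norm_num
  refine (LatentSpace.measure_opNorm_ge_le h.measurable_centeredEntry h.iIndepFun_centeredEntry hp
    hp1 (h.abs_centeredEntry_le hP hP1) (h.integral_centeredEntry hP)
    (fun e k hk => (h.abs_integral_centeredEntry_pow_le hP hP1 e hk).trans (hPp _ _ e.2.ne))
    (hd.trans hs1) (t := 10 ^ 5 * Real.sqrt d) (by positivity)).trans ?_
  refine mul_le_mul_of_nonneg_left ?_ (by positivity)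
  -- As `2 ^ s ≤ 4 * d`, the ratio is at most `4 * 10^7 / 10^10 = 1/250`; the power `2 ^ s ≥ log n`
  -- then turns `exp (-5)` into `n` to the minus five.
  have h1 : (10 ^ 7 * (2 ^ s : ℕ) / (10 ^ 5 * Real.sqrt d) ^ 2 : ℝ) ≤ Real.exp (-5) := by
    rw [hsd, div_le_iff₀ (by positivity)]
    have h2 : (1 / 250 : ℝ) ≤ Real.exp (-5) := by
      rw [Real.exp_neg, one_div]
      apply inv_anti₀ (Real.exp_pos _)
      have h3 := Real.exp_one_lt_d9
      calc Real.exp 5 = Real.exp 1 ^ 5 := by rw [← Real.exp_nat_mul]; norm_num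
        _ ≤ 2.7182818286 ^ 5 := pow_le_pow_left₀ (Real.exp_pos _).le h3.le 5
        _ ≤ 250 := by norm_num
    nlinarith
  calc _ ≤ Real.exp (-5) ^ (2 ^ s) := pow_le_pow_left₀ (by positivity) h1 _
    _ = Real.exp ((2 ^ s : ℕ) * (-5)) := (Real.exp_nat_mul _ _).symm
    _ ≤ _ := Real.exp_le_exp.mpr (by linarith)

lemma opNorm_diagonal_le {v : Fin n → ℝ} (hv : ∀ i, |v i| ≤ 1) : opNorm (diagonal v) ≤ 1 := by
  refine ContinuousLinearMap.opNorm_le_bound _ zero_le_one fun x => ?_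
  rw [one_mul]
  apply le_of_sq_le_sq _ (norm_nonneg _)
  rw [EuclideanSpace.real_norm_sq_eq, EuclideanSpace.real_norm_sq_eq]
  refine Finset.sum_le_sum fun i _ => ?_
  rw [Matrix.ofLp_toEuclideanCLM, mulVec_diagonal, mul_pow]
  have := (sq_le_one_iff_abs_le_one _).mpr (hv i)
  nlinarith [sq_nonneg (x.ofLp i)]

omit [IsProbabilityMeasure μ] in
-- `A` has zero diagonal but `P` does not; the diagonal correction has spectral norm at most one
-- when `P` has entries in `[0, 1]`, and is orthogonal to `X`.
lemma IsBernoulliNetwork.sub_eq (h : IsBernoulliNetwork μ P A) (hP : P.IsSymm) (ω : Ω) :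
    A ω - P = symMat (fun e => centeredEntry P A e ω) + diagonal fun i => -P i i := by
  have hA := (h.adjacency ω).1
  ext i j
  rw [Matrix.sub_apply, Matrix.add_apply]
  rcases lt_trichotomy i j with hij | hij | hij
  · simp [symMat, hij, hij.ne, centeredEntry]
  · subst hij
    rw [symMat_self, diagonal_apply_eq, (h.adjacency ω).2.1]
    ring
  · simp [symMat, hij, hij.ne', hij.not_gt, centeredEntry, hA.apply, hP.apply]

/-- With high probability the noise satisfies the requirements of the deterministic bound. -/
lemma IsBernoulliNetwork.measure_good_ge (h : IsBernoulliNetwork μ P A) (hPs : P.IsSymm)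
    (hP : ∀ i j, 0 ≤ P i j) {p : ℝ} (hp1 : p ≤ 1) (hPp : ∀ i j, i ≠ j → P i j ≤ p)
    (hP1 : ∀ i j, P i j ≤ 1) (hp : 0 ≤ p) (hn : 2 ≤ n) {d : ℝ} (hd : n * p ≤ d)
    (hd' : Real.log n ≤ d) {X : Matrix (Fin n) (Fin n) ℝ} (hX : IsCovariate X) {C₀ : ℝ}
    (hC : 10 ^ 6 ≤ C₀) :
    ENNReal.ofReal (1 - (n : ℝ) ^ (-1 : ℝ)) ≤
      μ {ω | 2 * opNorm (A ω - P) ≤ C₀ * Real.sqrt d ∧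
        |matInner (A ω - P) ((froNorm X)⁻¹ • X)| ≤ C₀ * Real.sqrt d} := by
  have hn2 : (2 : ℝ) ≤ n := by exact_mod_cast hn
  have hn0 : (0 : ℝ) < n := by linarith
  have hlog : Real.log 2 ≤ Real.log n := Real.log_le_log (by norm_num) hn2
  have hl2 := Real.log_two_gt_d9
  have hd0 : 1 / 4 ≤ d := by linarith
  have hsd : 1 / 2 ≤ Real.sqrt d := by
    apply Real.le_sqrt_of_sq_le; norm_num; linarith
  set H := (froNorm X)⁻¹ • X with hH
  have hHs : H.IsSymm := hX.1.smul _
  have hH0 : ∀ i, H i i = 0 := fun i => by rw [hH, Matrix.smul_apply, hX.2 i, smul_zero]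
  have hH1 : froNorm H ≤ 1 := by
    rw [hH, froNorm_smul, abs_of_nonneg (inv_nonneg.mpr (froNorm_nonneg X))]
    exact inv_mul_le_one
  have hC0 : 0 ≤ C₀ * Real.sqrt d := mul_nonneg (by linarith) (Real.sqrt_nonneg _)
  set B₁ := {ω | 10 ^ 5 * Real.sqrt d ≤ opNorm (symMat fun e => centeredEntry P A e ω)}
  set B₂ := {ω | C₀ * Real.sqrt d ≤ |matInner (symMat fun e => centeredEntry P A e ω) H|}
  set S := {ω | 2 * opNorm (A ω - P) ≤ C₀ * Real.sqrt d ∧ |matInner (A ω - P) H| ≤ C₀ * Real.sqrt d}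
  have hb1 : μ.real B₁ ≤ n * Real.exp (-5 * Real.log n) :=
    h.measure_opNorm_ge_le hP hp1 hPp hP1 hp hn hd hd'
  have hb2 : μ.real B₂ ≤ 2 * Real.exp (-(C₀ * Real.sqrt d) ^ 2 / 2) :=
    h.measure_abs_matInner_ge_le hP hHs hH1 hC0
  have hsub : Set.univ ⊆ S ∪ (B₁ ∪ B₂) := by
    intro ω _
    by_cases h1 : ω ∈ B₁
    · exact Or.inr (Or.inl h1)
    by_cases h2 : ω ∈ B₂
    · exact Or.inr (Or.inr h2)
    refine Or.inl ⟨?_, ?_⟩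
    · have h3 : opNorm (symMat fun e => centeredEntry P A e ω) < 10 ^ 5 * Real.sqrt d :=
        not_le.mp h1
      have h4 := opNorm_add_le (symMat fun e => centeredEntry P A e ω) (diagonal fun i => -P i i)
      rw [← h.sub_eq hPs] at h4
      have h5 : opNorm (diagonal fun i => -P i i) ≤ 1 :=
        opNorm_diagonal_le fun i => by rw [abs_neg, abs_of_nonneg (hP i i)]; exact hP1 i i
      -- With `√d ≥ 1/2` the diagonal contribution is at most `2 * √d`, and `2 * (10^5 + 2) ≤ C₀`.
      nlinarith
    · have h3 : |matInner (symMat fun e => centeredEntry P A e ω) H| < C₀ * Real.sqrt d :=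
        not_le.mp h2
      have h4 : matInner (A ω - P) H = matInner (symMat fun e => centeredEntry P A e ω) H := by
        rw [h.sub_eq hPs, matInner_comm, matInner_add_right, matInner_comm,
          matInner_comm H, add_eq_left]
        refine Finset.sum_eq_zero fun i _ => Finset.sum_eq_zero fun j _ => ?_
        by_cases hij : i = j
        · subst hij; rw [hH0, mul_zero]
        · rw [diagonal_apply_ne _ hij, zero_mul]
      rw [h4]; exact h3.le
  have h1 : 1 ≤ μ.real S + (μ.real B₁ + μ.real B₂) := by
    calc (1 : ℝ) = μ.real Set.univ := by simp
      _ ≤ μ.real (S ∪ (B₁ ∪ B₂)) := measureReal_mono hsub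
      _ ≤ μ.real S + μ.real (B₁ ∪ B₂) := measureReal_union_le _ _
      _ ≤ _ := by gcongr; exact measureReal_union_le _ _
  have hexp : ∀ k : ℕ, Real.exp (-(k * Real.log n)) = ((n : ℝ) ^ k)⁻¹ := fun k => by
    rw [Real.exp_neg, Real.exp_nat_mul, Real.exp_log hn0]
  have h2 : Real.exp (-5 * Real.log n) = ((n : ℝ) ^ 5)⁻¹ := by
    rw [← hexp 5]; push_cast; ring_nf
  have h3 : Real.exp (-(C₀ * Real.sqrt d) ^ 2 / 2) ≤ ((n : ℝ) ^ 5)⁻¹ := by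
    rw [← hexp 5]
    apply Real.exp_le_exp.mpr
    rw [mul_pow, Real.sq_sqrt (by linarith)]
    push_cast
    have : 10 ≤ C₀ ^ 2 := by nlinarith
    nlinarith
  have h4 : (n : ℝ) * ((n : ℝ) ^ 5)⁻¹ + 2 * ((n : ℝ) ^ 5)⁻¹ ≤ (n : ℝ) ^ (-1 : ℝ) := by
    rw [Real.rpow_neg_one, ← add_mul, ← div_eq_mul_inv, inv_eq_one_div, div_le_div_iff₀
      (by positivity) hn0]
    have h6 : (8 : ℝ) ≤ n ^ 3 := by
      calc (8 : ℝ) = 2 ^ 3 := by norm_num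
        _ ≤ _ := pow_le_pow_left₀ (by norm_num) hn2 3
    have h7 : (n : ℝ) ^ 5 = n ^ 3 * n ^ 2 := by ring
    rw [h7]
    nlinarith [sq_nonneg (n : ℝ)]
  rw [ENNReal.ofReal_le_iff_le_toReal (measure_ne_top _ _)]
  rw [h2] at hb1
  change _ ≤ μ.real S
  linarith

end BernoulliNetwork

lemma sigmoid_le_exp (x : ℝ) : Real.sigmoid x ≤ Real.exp x := by
  rw [Real.sigmoid_def]
  calc (1 + Real.exp (-x))⁻¹ ≤ (Real.exp (-x))⁻¹ :=
        inv_anti₀ (Real.exp_pos _) (by linarith [Real.exp_pos (-x)])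
    _ = _ := by rw [Real.exp_neg, inv_inv]

/-- Moving `n` into the maximum exhibits the same quantity as under the root in `lam`. -/
lemma psiSq_eq {n k : ℕ} (hn : 1 ≤ n) (M₁ M₂ : ℝ) : psiSq n k M₁ M₂ =
    Real.exp (2 * M₁) * k * max (n * Real.exp (-M₂)) (Real.log n) := by
  have hn0 : (0 : ℝ) < n := by exact_mod_cast hn
  rw [psiSq, ← mul_div_cancel₀ (Real.log n) hn0.ne', mul_div_assoc, ← mul_max_of_nonneg _ _ hn0.le]
  rw [mul_div_cancel₀ _ hn0.ne']
  ring

lemma isSymm_probMat_thetaMat {n : ℕ} {X G : Matrix (Fin n) (Fin n) ℝ} (hX : X.IsSymm)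
    (hG : G.IsSymm) (α : Fin n → ℝ) (β : ℝ) : (probMat (thetaMat X α β G)).IsSymm := by
  ext i j
  simp only [probMat, thetaMat, transpose_apply, of_apply, hX.apply i j, hG.apply i j,
    add_comm (α i)]

end LatentSpace

theorem theorem4p1 :
    ∃ M₀ : ℝ, 0 < M₀ ∧
      -- the deterministic bound
      (∃ C : ℝ, 0 < C ∧
        ∀ (n k : ℕ), 1 ≤ n → 1 ≤ k → ∀ (M₁ M₂ : ℝ), 0 ≤ M₂ → M₂ ≤ M₁ →
        ∀ X : Matrix (Fin n) (Fin n) ℝ, LatentSpace.IsCovariate X →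
        (X ≠ 0 → M₀ * k ≤ LatentSpace.stableRank X) →
        -- the true parameter
        ∀ (α : Fin n → ℝ) (β : ℝ) (Z : Matrix (Fin n) (Fin k) ℝ) (G Θ P : Matrix (Fin n) (Fin n) ℝ),
        LatentSpace.centering n * Z = Z → G = Z * Z.transpose →
        Θ = LatentSpace.thetaMat X α β G → LatentSpace.ThetaConstraint M₁ M₂ Θ →
        P = LatentSpace.probMat Θ →
        -- the observed network and the penalty level
        ∀ A : Matrix (Fin n) (Fin n) ℝ, LatentSpace.IsAdjacency A → ∀ lam : ℝ,
        2 * LatentSpace.opNorm (A - P) ≤ lam →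
        |LatentSpace.matInner (A - P) ((LatentSpace.froNorm X)⁻¹ • X)| / Real.sqrt k ≤ lam →
        1 ≤ lam →
        -- the estimates
        ∀ (αh : Fin n → ℝ) (βh : ℝ) (Gh : Matrix (Fin n) (Fin n) ℝ),
        LatentSpace.IsSolution A X M₁ M₂ lam αh βh Gh →
        LatentSpace.froNorm (Gh - G) ^ 2 ≤ C * Real.exp (2 * M₁) * lam ^ 2 * k ∧
        LatentSpace.froNorm (LatentSpace.thetaMat X αh βh Gh - Θ) ^ 2
          ≤ C * Real.exp (2 * M₁) * lam ^ 2 * k) ∧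
      -- the high-probability bound
      (∃ Cmin : ℝ, 0 < Cmin ∧ ∀ C₀ : ℝ, Cmin ≤ C₀ → ∃ c C : ℝ, 0 < c ∧ 0 < C ∧
        ∀ (n k : ℕ), 1 ≤ n → 1 ≤ k → ∀ (M₁ M₂ : ℝ), 0 ≤ M₂ → M₂ ≤ M₁ →
        ∀ X : Matrix (Fin n) (Fin n) ℝ, LatentSpace.IsCovariate X →
        (X ≠ 0 → M₀ * k ≤ LatentSpace.stableRank X) →
        -- the true parameter
        ∀ (α : Fin n → ℝ) (β : ℝ) (Z : Matrix (Fin n) (Fin k) ℝ) (G Θ P : Matrix (Fin n) (Fin n) ℝ),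
        LatentSpace.InParamSpace M₁ M₂ X α β Z → G = Z * Z.transpose →
        Θ = LatentSpace.thetaMat X α β G → LatentSpace.ThetaConstraint M₁ M₂ Θ →
        P = LatentSpace.probMat Θ →
        -- the penalty level and the random network
        ∀ lam : ℝ, lam = C₀ * Real.sqrt (max (n * Real.exp (-M₂)) (Real.log n)) →
        ∀ (Ω : Type*) [MeasurableSpace Ω] (μ : MeasureTheory.Measure Ω)
          [MeasureTheory.IsProbabilityMeasure μ] (A : Ω → Matrix (Fin n) (Fin n) ℝ),
        LatentSpace.IsBernoulliNetwork μ P A →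
        ENNReal.ofReal (1 - (n : ℝ) ^ (-c)) ≤
          μ {ω | ∀ (αh : Fin n → ℝ) (βh : ℝ) (Gh : Matrix (Fin n) (Fin n) ℝ),
            LatentSpace.IsSolution (A ω) X M₁ M₂ lam αh βh Gh →
            LatentSpace.froNorm (Gh - G) ^ 2 ≤ C * LatentSpace.psiSq n k M₁ M₂ ∧
            LatentSpace.froNorm (LatentSpace.thetaMat X αh βh Gh - Θ) ^ 2
              ≤ C * LatentSpace.psiSq n k M₁ M₂}) := by
  refine ⟨10000, by norm_num, ⟨9216, by norm_num, ?_⟩, 10 ^ 6, by norm_num, fun C₀ hC₀ =>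
    ⟨1, 9216 * C₀ ^ 2, one_pos, by positivity, ?_⟩⟩
  · rintro n k - hk M₁ M₂ h2 h12 X hX hstab α β Z G Θ P hZ rfl rfl hΘ rfl A hA lam hop hXE hlam
      αh βh Gh hsol
    exact LatentSpace.deterministic_bound hk h2 h12 hX hstab α β Z hZ hΘ hA hop hXE hlam αh βh Gh
      hsol
  · rintro n k hn hk M₁ M₂ h2 h12 X hX hstab α β Z G Θ P hpar rfl rfl hΘ rfl lam rfl Ω _ μ _ A hA
    -- For `n = 1` the claimed probability is `1 - 1 = 0`; from `n ≥ 2` on, `log n` keeps `lam`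
    -- above one.
    rcases hn.eq_or_lt with rfl | hn2
    · simp
    have hsymm : (Z * Z.transpose).IsSymm := by
      rw [Matrix.IsSymm, Matrix.transpose_mul, Matrix.transpose_transpose]
    refine (hA.measure_good_ge (p := Real.exp (-M₂))
      (LatentSpace.isSymm_probMat_thetaMat hX.1 hsymm α β)
      (fun i j => Real.sigmoid_nonneg _) (Real.exp_le_one_iff.mpr (by linarith))
      (fun i j hij => (LatentSpace.sigmoid_le_exp _).trans
        (Real.exp_le_exp.mpr (hΘ.1 i j hij).2)) (fun i j => Real.sigmoid_le_one _)
      (Real.exp_pos _).le hn2 (le_max_left _ _) (le_max_right _ _) hX hC₀).trans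
      (measure_mono ?_)
    rintro ω ⟨hop, hXE⟩ αh βh Gh hsol
    set d := max (n * Real.exp (-M₂)) (Real.log n) with hd
    have hd0 : 1 / 4 ≤ d := by
      have h3 := Real.log_le_log (by norm_num) (show (2 : ℝ) ≤ n by exact_mod_cast hn2)
      have h4 := Real.log_two_gt_d9
      exact le_trans (by linarith) (le_max_right _ _)
    have hsd : 1 / 2 ≤ Real.sqrt d := by
      apply Real.le_sqrt_of_sq_le; norm_num; linarith
    have hlam : 1 ≤ C₀ * Real.sqrt d := by nlinarith
    have hk1 : 1 ≤ Real.sqrt k := Real.one_le_sqrt.mpr (by exact_mod_cast hk)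
    -- Hoeffding already bounds the noise along `X` by `lam`, so the division by `√k ≥ 1` is not
    -- needed.
    have h := LatentSpace.deterministic_bound hk h2 h12 hX hstab α β Z hpar.1 hΘ (hA.adjacency ω)
      hop ((div_le_self (abs_nonneg _) hk1).trans hXE) hlam αh βh Gh hsol
    have e : 9216 * Real.exp (2 * M₁) * (C₀ * Real.sqrt d) ^ 2 * k =
        9216 * C₀ ^ 2 * LatentSpace.psiSq n k M₁ M₂ := by
      rw [LatentSpace.psiSq_eq hn, mul_pow, Real.sq_sqrt (by linarith), ← hd]
      ring
    rwa [e] at h
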